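/- **Setting.** Let $m_1,m_2,N\ge 1$, $d=m_1+m_2$, $m=\min(m_1,m_2)$. For a matrix $A\in\mathbb R^{m_1\times m_2}$ let $\|A\|_2$, $\|A\|_*$, $\|A\|$ and $\|A\|_\infty$ be the Frobenius norm, the nuclear norm, the operator norm and the largest absolute value of an entry, $\langle A,B\rangle=\mathrm{tr}(AB^\top)$, and let $A_I$ be $A$ with the entries outside an index set $I$ replaced by $0$; $|I|$ is the cardinality of $I$. One observes $(X_i,Y_i)$, $i=1,\dots,N$, with $$Y_i=\mathrm{tr}\big(X_i^\top(L_0+S_0)\big)+\xi_i,$$ where $L_0,S_0\in\mathbb R^{m_1\times m_2}$ are fixed, $r=\mathrm{rank}(L_0)$, $\|L_0\|_\infty\le\mathbf a$, $\|S_0\|_\infty\le\mathbf a$, every $X_i$ is a random matrix of the form $e_je_k^\top$, the noise variables $\xi_1,\dots,\xi_N$ are independent and centered, and $(X_i)_{i\le N}$ is independent of $(\xi_i)_{i\le N}$. The index pairs are split into $\mathcal I$ and its complement $\tilde{\mathcal I}$, and $S_0$ vanishes on $\mathcal I$. The set $\{1,\dots,N\}$ is the disjoint union of non-random sets $\Omega$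 and $\tilde\Omega$, with $n=|\Omega|\ge 1$. For $i\in\Omega$ the $X_i$ are i.i.d. with a distribution $\Pi$ on $\{e_je_k^\top:(j,k)\in\mathcal I\}$, $\pi_{jk}=\Pi(\{e_je_k^\top\})$. For $i\in\tilde\Omega$ the $X_i$ take values in $\{e_je_k^\top:(j,k)\in\tilde{\mathcal I}\}$, and nothing else is assumed about how they are sampled. All entries of $S_0$ that are not observed are $0$. Let $\text{æ}=N/n$, and let $\mathbf{Id}_{\tilde\Omega}$ be the matrix with entry $1$ at the index pairs observed by some $X_i$, $i\in\tilde\Omega$, and $0$ elsewhere. **Assumptions.** (1) For some $\mu\ge1$: $\pi_{jk}\ge(\mu|\mathcal I|)^{-1}$ for all $(j,k)\in\mathcal I$. (2) For some $L\ge1$: $\sum_j\pi_{jk}\le L/m$ for every $k$ and $\sum_k\pi_{jk}\le L/m$ for every $j$. (3) For some $\sigma,c_1>0$: $\mathbb E\exp(\xi_i^2/\sigma^2)<c_1$ for all $i=1,\dots,N$. **Regularizer and estimator.** Let $\mathcal R$ be a norm on $\mathbb R^{m_1\times m_2}$ that is absolute ($\mathcal R(A)$ depends only on the absolute values of the entries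 of $A$) and decomposable with respect to $\mathcal I$, that is, $\mathcal R(A)=\mathcal R(A_{\mathcal I})+\mathcal R(A_{\tilde{\mathcal I}})$ for all $A$; let $\mathcal R^*(A)=\sup_{\mathcal R(B)\le1}\langle A,B\rangle$. For $\lambda_1,\lambda_2>0$ let $$(\hat L,\hat S)\in\operatorname*{arg\,min}_{\|L\|_\infty\le\mathbf a,\ \|S\|_\infty\le\mathbf a}\Big\{\frac1N\sum_{i=1}^N\big(Y_i-\langle X_i,L+S\rangle\big)^2+\lambda_1\|L\|_*+\lambda_2\mathcal R(S)\Big\}.$$ Put $$\Sigma=\frac1N\sum_{i\in\Omega}\xi_iX_i,\qquad W=\frac1N\sum_{i\in\Omega}X_i,\qquad \Sigma_R=\frac1n\sum_{i\in\Omega}\epsilon_iX_i,$$ where the $\epsilon_i$ are i.i.d. Rademacher variables independent of the $X_i$, and $$\begin{aligned} \Psi_1&=\mu^2m_1m_2\,r\big(\text{æ}^2\lambda_1^2+\mathbf a^2(\mathbb E\|\Sigma_R\|)^2\big)+\mathbf a^2\mu\sqrt{\tfrac{\log d}{n}},\\ \Psi_2&=\mu\,\mathbf a\,\mathcal R(\mathbf{Id}_{\tilde\Omega})\Big(\tfrac{\lambda_2\mathbf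 a}{\lambda_1}\mathbb E\|\Sigma_R\|+\text{æ}\lambda_2+\mathbf a\,\mathbb E\mathcal R^*(\Sigma_R)\Big),\\ \Psi_3&=\frac{\mu|\tilde\Omega|(\mathbf a^2+\sigma^2\log d)}{N}\Big(\frac{\mathbf a\,\mathbb E\|\Sigma_R\|}{\lambda_1}+\frac{\mathbf a\,\mathbb E\mathcal R^*(\Sigma_R)}{\lambda_2}+\text{æ}\Big)+\frac{\mathbf a^2|\tilde{\mathcal I}|}{m_1m_2},\\ \Psi_4&=\mu\,\mathbf a^2\sqrt{\tfrac{\log d}{n}}+\mu\,\mathbf a\,\mathcal R(\mathbf{Id}_{\tilde\Omega})\big(\text{æ}\lambda_2+\mathbf a\,\mathbb E\mathcal R^*(\Sigma_R)\big)+\Big(\frac{\mathbf a\,\mathbb E\mathcal R^*(\Sigma_R)}{\lambda_2}+\text{æ}\Big)\frac{\mu|\tilde\Omega|(\mathbf a^2+\sigma^2\log d)}{N}. \end{aligned}$$ **Theorem.** There is a constant $C>0$ that depends only on $c_1$ such that, in the setting above, with probability at least $1-4.5\,d^{-1}$ the following holds simultaneously for all $\lambda_1>4\|\Sigma\|$,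 all $\lambda_2>0$ with $\lambda_2\ge4\big(\mathcal R^*(\Sigma)+2\mathbf a\mathcal R^*(W)\big)$, and all minimisers $(\hat L,\hat S)$: $$\frac{\|L_0-\hat L\|_2^2}{m_1m_2}+\frac{\|S_0-\hat S\|_2^2}{m_1m_2}\le C\,(\Psi_1+\Psi_2+\Psi_3)\qquad\text{and}\qquad\frac{\|\hat S_{\mathcal I}\|_2^2}{|\mathcal I|}\le C\,\Psi_4.$$ -/

import Mathlib

open MeasureTheory ProbabilityTheory

namespace RobustCompletion

noncomputable section

/-- The element `e_j(m₁) e_k(m₂)ᵀ` of the canonical basis of `m₁ × m₂` matrices, `p = (j, k)`. -/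
def basisMatrix {m₁ m₂ : ℕ} (p : Fin m₁ × Fin m₂) : Matrix (Fin m₁) (Fin m₂) ℝ :=
  Matrix.single p.1 p.2 1

/-- The inner product `⟨A, B⟩ = tr(A Bᵀ)`. -/
def matInner {m₁ m₂ : ℕ} (A B : Matrix (Fin m₁) (Fin m₂) ℝ) : ℝ :=
  (A * B.transpose).trace

/-- The restriction `A_I`: entries outside the index set `I` are replaced by `0`. -/
def restrict {m₁ m₂ : ℕ} (I : Finset (Fin m₁ × Fin m₂)) (A : Matrix (Fin m₁) (Fin m₂) ℝ) :
    Matrix (Fin m₁) (Fin m₂) ℝ :=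
  Matrix.of fun j k => if (j, k) ∈ I then A j k else 0

/-- The matrix of ones restricted to the index set `I`. -/
def onesOn {m₁ m₂ : ℕ} (I : Finset (Fin m₁ × Fin m₂)) : Matrix (Fin m₁) (Fin m₂) ℝ :=
  restrict I (Matrix.of fun _ _ => 1)

/-- The squared Frobenius norm. -/
def frobSq {m₁ m₂ : ℕ} (A : Matrix (Fin m₁) (Fin m₂) ℝ) : ℝ :=
  ∑ j, ∑ k, A j k ^ 2

/-- The operator norm with respect to the Euclidean norms (the largest singular value). -/
def opNorm {m₁ m₂ : ℕ} (A : Matrix (Fin m₁) (Fin m₂) ℝ) : ℝ :=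
  ‖LinearMap.toContinuousLinearMap (Matrix.toEuclideanLin A)‖

/-- The nuclear norm: the sum of the singular values. (There are `m₂` of them, with zeros;
Mathlib continues the sequence by zero.) -/
def nuclearNorm {m₁ m₂ : ℕ} (A : Matrix (Fin m₁) (Fin m₂) ℝ) : ℝ :=
  ∑ k : Fin m₂, (Matrix.toEuclideanLin A).singularValues k

/-- `‖A‖_∞ ≤ a` for the entrywise sup norm. -/
def SupNormLE {m₁ m₂ : ℕ} (A : Matrix (Fin m₁) (Fin m₂) ℝ) (a : ℝ) : Prop :=
  ∀ j k, |A j k| ≤ a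

/-- The seminorm `R` is a norm. -/
def IsNorm {m₁ m₂ : ℕ} (R : Seminorm ℝ (Matrix (Fin m₁) (Fin m₂) ℝ)) : Prop :=
  ∀ A, R A = 0 → A = 0

/-- `R` is absolute: it depends only on the absolute values of the entries. -/
def IsAbsolute {m₁ m₂ : ℕ} (R : Seminorm ℝ (Matrix (Fin m₁) (Fin m₂) ℝ)) : Prop :=
  ∀ A, R A = R (A.map fun x => |x|)

/-- `R` is decomposable with respect to the index set `I`. -/
def IsDecomposable {m₁ m₂ : ℕ} (R : Seminorm ℝ (Matrix (Fin m₁) (Fin m₂) ℝ))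
    (I : Finset (Fin m₁ × Fin m₂)) : Prop :=
  ∀ A, R A = R (restrict I A) + R (restrict Iᶜ A)

/-- The dual norm `R*(A) = sup {⟨A, B⟩ : R(B) ≤ 1}`. -/
def dualNorm {m₁ m₂ : ℕ} (R : Seminorm ℝ (Matrix (Fin m₁) (Fin m₂) ℝ))
    (A : Matrix (Fin m₁) (Fin m₂) ℝ) : ℝ :=
  sSup {t | ∃ B, R B ≤ 1 ∧ t = matInner A B}

/-- `Σ = N⁻¹ ∑_{i ∈ Ω} ξ_i X_i`, where `x i` is the position of the single one in `X_i`. -/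
def sigmaTerm {m₁ m₂ N : ℕ} (Om : Finset (Fin N)) (x : Fin N → Fin m₁ × Fin m₂)
    (ξ : Fin N → ℝ) : Matrix (Fin m₁) (Fin m₂) ℝ :=
  (N : ℝ)⁻¹ • ∑ i ∈ Om, ξ i • basisMatrix (x i)

/-- `W = N⁻¹ ∑_{i ∈ Ω} X_i`. -/
def wTerm {m₁ m₂ N : ℕ} (Om : Finset (Fin N)) (x : Fin N → Fin m₁ × Fin m₂) :
    Matrix (Fin m₁) (Fin m₂) ℝ :=
  (N : ℝ)⁻¹ • ∑ i ∈ Om, basisMatrix (x i)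

/-- `Σ_R = n⁻¹ ∑_{i ∈ Ω} ε_i X_i` with `n = |Ω|` and signs `ε_i = ±1`. -/
def sigmaR {m₁ m₂ N : ℕ} (Om : Finset (Fin N)) (x : Fin N → Fin m₁ × Fin m₂)
    (ε : Fin N → ℤˣ) : Matrix (Fin m₁) (Fin m₂) ℝ :=
  (Om.card : ℝ)⁻¹ • ∑ i ∈ Om, (((ε i : ℤ) : ℝ)) • basisMatrix (x i)

/-- The expectation `E[f(Σ_R)]`, where the `ε_i` are independent uniform signs, independent of the
`X_i`: the average over all sign vectors inside the expectation over the positions `X`. -/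
def expSigmaR {S : Type*} [MeasurableSpace S] (P : Measure S) {m₁ m₂ N : ℕ}
    (Om : Finset (Fin N)) (X : Fin N → S → Fin m₁ × Fin m₂)
    (f : Matrix (Fin m₁) (Fin m₂) ℝ → ℝ) : ℝ :=
  ∫ ω, (∑ ε : Fin N → ℤˣ, f (sigmaR Om (fun i => X i ω) ε)) / 2 ^ N ∂P

/-- The set of index pairs of the corrupted observations. -/
def corruptedEntries {m₁ m₂ N : ℕ} (Om : Finset (Fin N)) (x : Fin N → Fin m₁ × Fin m₂) :
    Finset (Fin m₁ × Fin m₂) :=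
  Omᶜ.image x

/-- The objective function of the convex program. -/
def objective {m₁ m₂ N : ℕ} (R : Seminorm ℝ (Matrix (Fin m₁) (Fin m₂) ℝ)) (l₁ l₂ : ℝ)
    (x : Fin N → Fin m₁ × Fin m₂) (y : Fin N → ℝ) (L S : Matrix (Fin m₁) (Fin m₂) ℝ) : ℝ :=
  (N : ℝ)⁻¹ * ∑ i, (y i - matInner (basisMatrix (x i)) (L + S)) ^ 2
    + l₁ * nuclearNorm L + l₂ * R S

/-- `(L, S)` minimises the objective function over `‖L‖_∞ ≤ a`, `‖S‖_∞ ≤ a`. -/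
def IsEstimator {m₁ m₂ N : ℕ} (R : Seminorm ℝ (Matrix (Fin m₁) (Fin m₂) ℝ)) (a l₁ l₂ : ℝ)
    (x : Fin N → Fin m₁ × Fin m₂) (y : Fin N → ℝ) (L S : Matrix (Fin m₁) (Fin m₂) ℝ) : Prop :=
  SupNormLE L a ∧ SupNormLE S a ∧
    ∀ L' S', SupNormLE L' a → SupNormLE S' a →
      objective R l₁ l₂ x y L S ≤ objective R l₁ l₂ x y L' S'

/-! In the four quantities below, `n` and `N` are the numbers of non-corrupted and of all
observations, `ct = N - n`, `ae = N / n`, `RId` is `R(Id_Ω̃)`, `EOp` is `E‖Σ_R‖`, `EDual` is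
`E R*(Σ_R)`, `cI` is the cardinality of the complement of the index set `I`, `r` is the rank. -/

def psi1 (m₁ m₂ n N r : ℕ) (μ a l₁ EOp : ℝ) : ℝ :=
  μ ^ 2 * m₁ * m₂ * r * (((N : ℝ) / n) ^ 2 * l₁ ^ 2 + a ^ 2 * EOp ^ 2)
    + a ^ 2 * μ * √(Real.log ((m₁ : ℝ) + m₂) / n)

def psi2 (n N : ℕ) (μ a l₁ l₂ RId EOp EDual : ℝ) : ℝ :=
  μ * a * RId * (l₂ * a / l₁ * EOp + (N : ℝ) / n * l₂ + a * EDual)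

def psi3 (m₁ m₂ n N ct cI : ℕ) (μ a σ l₁ l₂ EOp EDual : ℝ) : ℝ :=
  μ * ct * (a ^ 2 + σ ^ 2 * Real.log ((m₁ : ℝ) + m₂)) / N
      * (a * EOp / l₁ + a * EDual / l₂ + (N : ℝ) / n)
    + a ^ 2 * cI / (m₁ * m₂)

def psi4 (m₁ m₂ n N ct : ℕ) (μ a σ l₂ RId EDual : ℝ) : ℝ :=
  μ * a ^ 2 * √(Real.log ((m₁ : ℝ) + m₂) / n)
    + μ * a * RId * ((N : ℝ) / n * l₂ + a * EDual)
    + (a * EDual / l₂ + (N : ℝ) / n)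
      * (μ * ct * (a ^ 2 + σ ^ 2 * Real.log ((m₁ : ℝ) + m₂)) / N)

end

end RobustCompletion

/-!
The argument has a deterministic and a probabilistic half.

*Deterministic half.* Comparing the objective at the minimiser `(L, S)` with its values at `(L, S₀)`
and at `(L₀, S₀)` gives two basic inequalities (`sum_sq_sparse_le`, `sum_sq_add_le`). The conditions
on `l₁`, `l₂` make the noise terms, bounded by duality, at most half of the regularization terms.
The first inequality bounds both the empirical second moment of `S` on the non-corrupted observations
and `R (restrict I S)`. In the second one, the nuclear norm is decomposable at `L₀`
(`exists_nuclearNorm_compression`): up to a multiple of `√r ‖L₀ - L‖₂`, the penalty acts on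
`L₀ - L` as the nuclear norm of its compression to the orthogonal complements of the range and
coimage of `L₀`. So this inequality controls the empirical second moment of `L₀ - L + S₀ - S` and
the nuclear norm of `L₀ - L`. Singular values enter only
through an orthonormal basis that is mapped to an orthogonal system
(`exists_orthonormalBasis_singularValues`).

*Probabilistic half.* What remains is to pass from empirical to population second moments, for all
bounded matrices `B` at once, at the price of a term linear in the norm `g B` with factor
`E gs(Σ_R)` for the dual norm `gs`, and a term `√(log d / n)`; this is `exists_event_sum_sq_le`. As
these sums involve only finitely many positions, the expectations are finite sums over product
spaces. Symmetrization and contraction are done one coordinate at a time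
(`sum_iSup_centred_sq_le`), the fluctuation is bounded by McDiarmid's inequality
(`prodExp_indicator_le_exp`), and a union bound over the dyadic slices of `g B` makes the bound
uniform in `B`. Since the event does not refer to `l₁`, `l₂`, the error bounds hold for all of them
simultaneously. It is used for the nuclear norm with `L₀ - L` and for `R` with `restrict I S`. The
corrupted noise is bounded by Markov's and Jensen's inequalities for `exp`
(`exists_event_sum_noise_sq_le`); each of the three events fails with probability at most `1 / d`.

Finally `sparse_error_le` and `lowRank_error_le` combine the two halves; the terms linear in
`‖L₀ - L‖₂` are absorbed into its square. The lower bound on the sampling distribution turns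
population moments into Frobenius norms, and the entries outside `I` contribute at most `4 a²` each.
-/

namespace RobustCompletion

/-! ### Trace duality and decomposability of the trace norm -/

section TraceDuality

open LinearMap Module

variable {E F : Type*} [NormedAddCommGroup E] [InnerProductSpace ℝ E] [FiniteDimensional ℝ E]
  [NormedAddCommGroup F] [InnerProductSpace ℝ F] [FiniteDimensional ℝ F]

/-- The Hilbert–Schmidt inner product `tr(B† A)` of two linear maps. -/
noncomputable def hsInner (A B : E →ₗ[ℝ] F) : ℝ :=
  LinearMap.trace ℝ E (LinearMap.adjoint B ∘ₗ A)

theorem hsInner_eq_sum {ι : Type*} [Fintype ι] (b : OrthonormalBasis ι ℝ E) (A B : E →ₗ[ℝ] F) :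
    hsInner A B = ∑ i, inner ℝ (B (b i)) (A (b i)) := by
  simp [hsInner, LinearMap.trace_eq_sum_inner _ b, LinearMap.adjoint_inner_right]

theorem hsInner_add_left (A A' B : E →ₗ[ℝ] F) :
    hsInner (A + A') B = hsInner A B + hsInner A' B := by
  simp [hsInner, LinearMap.comp_add]

theorem hsInner_sub_left (A A' B : E →ₗ[ℝ] F) :
    hsInner (A - A') B = hsInner A B - hsInner A' B := by
  simp [hsInner, LinearMap.comp_sub]

theorem hsInner_sub_right (A B B' : E →ₗ[ℝ] F) :
    hsInner A (B - B') = hsInner A B - hsInner A B' := by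
  simp [hsInner, LinearMap.sub_comp]

theorem hsInner_comp_left {P : F →ₗ[ℝ] F} (hP : LinearMap.adjoint P = P) (A B : E →ₗ[ℝ] F) :
    hsInner A (P ∘ₗ B) = hsInner (P ∘ₗ A) B := by
  simp [hsInner, LinearMap.adjoint_comp, hP, LinearMap.comp_assoc]

theorem hsInner_comp_right {Q : E →ₗ[ℝ] E} (hQ : LinearMap.adjoint Q = Q) (A B : E →ₗ[ℝ] F) :
    hsInner A (B ∘ₗ Q) = hsInner (A ∘ₗ Q) B := by
  simp only [hsInner, LinearMap.adjoint_comp, hQ]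
  rw [LinearMap.comp_assoc, LinearMap.trace_comp_comm', LinearMap.comp_assoc]

theorem hsInner_adjoint (A B : E →ₗ[ℝ] F) :
    hsInner (LinearMap.adjoint B) (LinearMap.adjoint A) = hsInner A B := by
  simp only [hsInner, LinearMap.adjoint_adjoint]
  rw [LinearMap.trace_comp_comm']

theorem hsInner_comm (A B : E →ₗ[ℝ] F) : hsInner A B = hsInner B A := by
  simp only [hsInner_eq_sum (stdOrthonormalBasis ℝ E), real_inner_comm]

theorem hsInner_le_sqrt_mul_sqrt (A B : E →ₗ[ℝ] F) :
    hsInner A B ≤ √(hsInner A A) * √(hsInner B B) := by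
  set b := stdOrthonormalBasis ℝ E
  simp only [hsInner_eq_sum b]
  calc ∑ i, inner ℝ (B (b i)) (A (b i))
      ≤ ∑ i, ‖A (b i)‖ * ‖B (b i)‖ := Finset.sum_le_sum fun i _ => by
        rw [mul_comm]; exact real_inner_le_norm _ _
    _ ≤ √(∑ i, ‖A (b i)‖ ^ 2) * √(∑ i, ‖B (b i)‖ ^ 2) :=
        Real.sum_mul_le_sqrt_mul_sqrt _ _ _
    _ = _ := by simp only [real_inner_self_eq_norm_sq]

/-- The sum of the singular values of a linear map. -/
noncomputable def traceNorm (A : E →ₗ[ℝ] F) : ℝ :=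
  ∑ k : Fin (finrank ℝ E), A.singularValues k

theorem traceNorm_nonneg (A : E →ₗ[ℝ] F) : 0 ≤ traceNorm A :=
  Finset.sum_nonneg fun k _ => A.singularValues_nonneg k

/-- Singular value decomposition: `A` maps some orthonormal basis to an orthogonal system, whose
norms are the singular values. -/
theorem exists_orthonormalBasis_singularValues (A : E →ₗ[ℝ] F) :
    ∃ v : OrthonormalBasis (Fin (finrank ℝ E)) ℝ E,
      (∀ k, ‖A (v k)‖ = A.singularValues k) ∧
      ∀ k l, k ≠ l → inner ℝ (A (v k)) (A (v l)) = 0 := by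
  have hT := A.isSymmetric_adjoint_comp_self
  have key : ∀ k l, inner ℝ (A (hT.eigenvectorBasis rfl k)) (A (hT.eigenvectorBasis rfl l))
      = hT.eigenvalues rfl l *
        inner ℝ (hT.eigenvectorBasis rfl k) (hT.eigenvectorBasis rfl l) := by
    intro k l
    have h := hT.apply_eigenvectorBasis rfl l
    rw [← LinearMap.adjoint_inner_right]
    rw [LinearMap.comp_apply] at h
    rw [h, inner_smul_right]
    simp
  refine ⟨hT.eigenvectorBasis rfl, fun k => ?_, fun k l hkl => ?_⟩
  · have h1 := key k k
    rw [real_inner_self_eq_norm_sq, real_inner_self_eq_norm_sq,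
      (hT.eigenvectorBasis rfl).norm_eq_one] at h1
    rw [A.singularValues_fin rfl k, ← Real.sqrt_sq (norm_nonneg (A _)), h1]
    simp
  · rw [key, (hT.eigenvectorBasis rfl).inner_eq_zero hkl, mul_zero]

/-- Trace duality between the operator norm and the trace norm. -/
theorem hsInner_le_mul_traceNorm (A B : E →ₗ[ℝ] F) (c : ℝ) (hB : ∀ x, ‖B x‖ ≤ c * ‖x‖) :
    hsInner A B ≤ c * traceNorm A := by
  obtain ⟨v, hv, -⟩ := exists_orthonormalBasis_singularValues A
  rw [hsInner_eq_sum v, traceNorm, Finset.mul_sum]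
  refine Finset.sum_le_sum fun k _ => (real_inner_le_norm _ _).trans ?_
  rw [hv]
  refine mul_le_mul_of_nonneg_right ?_ (A.singularValues_nonneg k)
  simpa using hB (v k)

/-- The trace norm is attained in trace duality, at the partial isometry of the polar
decomposition. -/
theorem exists_hsInner_eq_traceNorm (A : E →ₗ[ℝ] F) :
    ∃ B : E →ₗ[ℝ] F, (∀ x, ‖B x‖ ≤ ‖x‖) ∧ hsInner A B = traceNorm A := by
  obtain ⟨v, hv, horth⟩ := exists_orthonormalBasis_singularValues A
  set u : Fin (finrank ℝ E) → F := fun k => (‖A (v k)‖⁻¹) • A (v k) with hu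
  let B : E →ₗ[ℝ] F := v.toBasis.constr ℝ u
  have hBv : ∀ k, B (v k) = u k := fun k => by
    rw [← v.coe_toBasis]
    exact v.toBasis.constr_basis ℝ u k
  refine ⟨B, fun x => ?_, ?_⟩
  · have hBx : B x = ∑ k, (v.repr x k) • u k := by
      conv_lhs => rw [← v.sum_repr x]
      simp [hBv]
    have h1 : ‖B x‖ ^ 2 = ∑ k, (v.repr x k) ^ 2 * ‖u k‖ ^ 2 := by
      rw [hBx, ← real_inner_self_eq_norm_sq, sum_inner]
      refine Finset.sum_congr rfl fun k _ => ?_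
      rw [inner_sum, Finset.sum_eq_single k]
      · rw [inner_smul_left, inner_smul_right, real_inner_self_eq_norm_sq]
        simp; ring
      · intro l _ hl
        rw [inner_smul_left, inner_smul_right, hu]
        simp only [inner_smul_left, inner_smul_right]
        rw [horth k l hl.symm]; simp
      · simp
    have h2 : ∀ k, ‖u k‖ ^ 2 ≤ 1 := by
      intro k
      rw [hu]
      simp only [norm_smul, norm_inv, norm_norm]
      by_cases h : ‖A (v k)‖ = 0
      · simp [h]
      · rw [inv_mul_cancel₀ h]; simp
    have h3 : ‖x‖ ^ 2 = ∑ k, (v.repr x k) ^ 2 := by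
      rw [← v.repr.norm_map x, EuclideanSpace.norm_sq_eq]; simp
    have : ‖B x‖ ^ 2 ≤ ‖x‖ ^ 2 := by
      rw [h1, h3]
      exact Finset.sum_le_sum fun k _ => mul_le_of_le_one_right (sq_nonneg _) (h2 k)
    exact le_of_sq_le_sq this (norm_nonneg _)
  · rw [hsInner_eq_sum v, traceNorm]
    refine Finset.sum_congr rfl fun k _ => ?_
    rw [hBv, hu, inner_smul_left, real_inner_self_eq_norm_sq, ← hv]
    by_cases h : ‖A (v k)‖ = 0
    · simp [h]
    · simp; field_simp

/-- A contraction composed with the orthogonal projection onto `W` has Hilbert–Schmidt norm at most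
that of the projection, which is `√(dim W)`. -/
theorem hsInner_self_le_of_comp_starProjection (W : Submodule ℝ E) (B : E →ₗ[ℝ] F)
    (hB : ∀ x, ‖B x‖ ≤ ‖x‖) :
    hsInner (B ∘ₗ (W.starProjection : E →ₗ[ℝ] E)) (B ∘ₗ (W.starProjection : E →ₗ[ℝ] E))
      ≤ finrank ℝ W := by
  set b := stdOrthonormalBasis ℝ E
  have htr : LinearMap.trace ℝ E (W.starProjection : E →ₗ[ℝ] E) = finrank ℝ W := by
    have h : LinearMap.IsProj W (W.starProjection : E →ₗ[ℝ] E) :=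
      ⟨fun x => by simp, fun x hx => by
        simpa using Submodule.starProjection_eq_self_iff.2 hx⟩
    exact h.trace
  rw [← htr, LinearMap.trace_eq_sum_inner _ b, hsInner_eq_sum b]
  refine Finset.sum_le_sum fun i _ => ?_
  rw [real_inner_self_eq_norm_sq]
  calc ‖B (W.starProjection (b i))‖ ^ 2 ≤ ‖W.starProjection (b i)‖ ^ 2 := by
        gcongr; exact hB _
    _ = inner ℝ (b i) (W.starProjection (b i)) := by
        rw [← real_inner_self_eq_norm_sq]
        rw [Submodule.inner_starProjection_left_eq_right]
        congr 1
        exact Submodule.starProjection_eq_self_iff.2 (by simp)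

theorem adjoint_starProjection (W : Submodule ℝ E) :
    LinearMap.adjoint (W.starProjection : E →ₗ[ℝ] E) = W.starProjection := by
  symm
  rw [LinearMap.eq_adjoint_iff]
  intro x y
  simpa using Submodule.inner_starProjection_left_eq_right W x y

theorem norm_adjoint_apply_le (B : E →ₗ[ℝ] F) (hB : ∀ x, ‖B x‖ ≤ ‖x‖) (y : F) :
    ‖LinearMap.adjoint B y‖ ≤ ‖y‖ := by
  have h : ‖LinearMap.adjoint B y‖ * ‖LinearMap.adjoint B y‖ ≤ ‖y‖ * ‖LinearMap.adjoint B y‖ := by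
    rw [← real_inner_self_eq_norm_mul_norm, LinearMap.adjoint_inner_left]
    exact (real_inner_le_norm _ _).trans (by gcongr; exact hB _)
  by_cases h0 : ‖LinearMap.adjoint B y‖ = 0
  · rw [h0]; positivity
  · exact le_of_mul_le_mul_right h (lt_of_le_of_ne (norm_nonneg _) (Ne.symm h0))

theorem hsInner_comp_starProjection_le (W : Submodule ℝ E) (A B : E →ₗ[ℝ] F)
    (hB : ∀ x, ‖B x‖ ≤ ‖x‖) :
    hsInner A (B ∘ₗ (W.starProjection : E →ₗ[ℝ] E)) ≤ √(finrank ℝ W) * √(hsInner A A) := by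
  rw [mul_comm]
  refine (hsInner_le_sqrt_mul_sqrt _ _).trans ?_
  gcongr
  exact hsInner_self_le_of_comp_starProjection W B hB

theorem hsInner_starProjection_comp_le (W : Submodule ℝ F) (A B : E →ₗ[ℝ] F)
    (hB : ∀ x, ‖B x‖ ≤ ‖x‖) :
    hsInner A ((W.starProjection : F →ₗ[ℝ] F) ∘ₗ B) ≤ √(finrank ℝ W) * √(hsInner A A) := by
  have h := hsInner_comp_starProjection_le W (LinearMap.adjoint A) (LinearMap.adjoint B)
    (norm_adjoint_apply_le B hB)
  rw [hsInner_adjoint] at h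
  rw [← hsInner_adjoint, LinearMap.adjoint_comp, adjoint_starProjection]
  rwa [hsInner_comm]

/-- Decomposability of the trace norm at a map `T` of rank `r`: up to a part of rank at most `2r`,
the perturbation `T - T'` can be replaced by its compression to the orthogonal complements of the
range and the coimage of `T`, and the trace norm is additive along this splitting. The number `q`
is the trace norm of the compression. -/
theorem exists_traceNorm_compression (T T' : E →ₗ[ℝ] F) :
    ∃ q : ℝ, 0 ≤ q ∧
      traceNorm (T - T') ≤ q + 2 * √(finrank ℝ T.range) * √(hsInner (T - T') (T - T')) ∧
      traceNorm T - traceNorm T' ≤ √(finrank ℝ T.range) * √(hsInner (T - T') (T - T')) - q := by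
  set r := √(finrank ℝ T.range : ℝ)
  set D := T - T' with hD
  set f := √(hsInner D D)
  let P : F →ₗ[ℝ] F := (T.range.starProjection : F →ₗ[ℝ] F)
  let P' : F →ₗ[ℝ] F := (T.rangeᗮ.starProjection : F →ₗ[ℝ] F)
  let Q : E →ₗ[ℝ] E := (T.kerᗮ.starProjection : E →ₗ[ℝ] E)
  let Q' : E →ₗ[ℝ] E := (T.ker.starProjection : E →ₗ[ℝ] E)
  have hP : LinearMap.adjoint P = P := adjoint_starProjection _
  have hP' : LinearMap.adjoint P' = P' := adjoint_starProjection _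
  have hQ : LinearMap.adjoint Q = Q := adjoint_starProjection _
  have hQ' : LinearMap.adjoint Q' = Q' := adjoint_starProjection _
  have hPP : ∀ y, P y + P' y = y := fun y =>
    Submodule.starProjection_add_starProjection_orthogonal (K := T.range) y
  have hQQ : ∀ x, Q' x + Q x = x := fun x =>
    Submodule.starProjection_add_starProjection_orthogonal (K := T.ker) x
  have hTQ' : ∀ x, T (Q' x) = 0 := fun x => by
    have : Q' x ∈ T.ker := Submodule.starProjection_apply_mem _ _
    simpa using this
  have hPT : ∀ x, P (T x) = T x := fun x =>
    Submodule.starProjection_eq_self_iff.2 (LinearMap.mem_range_self T x)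
  have hTQ : ∀ x, T (Q x) = T x := fun x => by
    have := congrArg T (hQQ x); rw [map_add, hTQ', zero_add] at this; exact this
  have hfr : (finrank ℝ (T.ker)ᗮ) = finrank ℝ T.range := by
    have h1 := T.ker.finrank_add_finrank_orthogonal
    have h2 := T.finrank_range_add_finrank_ker
    omega
  have nP' : ∀ y, ‖P' y‖ ≤ ‖y‖ := fun y => Submodule.norm_starProjection_apply_le _ y
  have nQ : ∀ y, ‖Q y‖ ≤ ‖y‖ := fun y => Submodule.norm_starProjection_apply_le _ y
  have nP : ∀ y, ‖P y‖ ≤ ‖y‖ := fun y => Submodule.norm_starProjection_apply_le _ y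
  set D2 := P' ∘ₗ D ∘ₗ Q' with hD2
  have boundP : ∀ B : E →ₗ[ℝ] F, (∀ x, ‖B x‖ ≤ ‖x‖) → hsInner D (P ∘ₗ B) ≤ r * f :=
    fun B hB => hsInner_starProjection_comp_le _ D B hB
  have boundQ : ∀ B : E →ₗ[ℝ] F, (∀ x, ‖B x‖ ≤ ‖x‖) → hsInner D (B ∘ₗ Q) ≤ r * f := by
    intro B hB
    have := hsInner_comp_starProjection_le (T.ker)ᗮ D B hB
    rwa [hfr] at this
  refine ⟨traceNorm D2, traceNorm_nonneg _, ?_, ?_⟩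
  · obtain ⟨B, hB, hBD⟩ := exists_hsInner_eq_traceNorm D
    have hsplit : D = D2 + P ∘ₗ D + (P' ∘ₗ D) ∘ₗ Q := by
      ext x
      simp only [hD2, LinearMap.add_apply, LinearMap.comp_apply]
      have e1 := hPP (D x)
      have e2 : P' (D (Q' x)) + P' (D (Q x)) = P' (D x) := by
        rw [← map_add, ← map_add, hQQ]
      rw [add_comm (P' _) (P _), add_assoc, e2, e1]
    have e : hsInner D B = hsInner D2 B + hsInner D (P ∘ₗ B) + hsInner D ((P' ∘ₗ B) ∘ₗ Q) := by
      rw [hsInner_comp_left hP, hsInner_comp_right hQ, hsInner_comp_left hP',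
        ← hsInner_add_left, ← hsInner_add_left]
      conv_lhs => rw [hsplit]
      rfl
    have h1 : hsInner D2 B ≤ traceNorm D2 := by
      simpa using hsInner_le_mul_traceNorm D2 B 1 (by simpa using hB)
    have h2 := boundP B hB
    have h3 := boundQ (P' ∘ₗ B) fun x => (nP' _).trans (hB x)
    rw [← hBD, e]
    linarith
  · obtain ⟨B₁, hB₁, hB₁T⟩ := exists_hsInner_eq_traceNorm T
    obtain ⟨B₂, hB₂, hB₂D⟩ := exists_hsInner_eq_traceNorm D2
    -- the test map for `T'`: the polar parts of `T` and `-D2` act on orthogonal subspaces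
    set B := P ∘ₗ (B₁ ∘ₗ Q) - P' ∘ₗ (B₂ ∘ₗ Q') with hB
    have hBc : ∀ x, ‖B x‖ ≤ 1 * ‖x‖ := by
      intro x
      have horth : inner ℝ (P (B₁ (Q x))) (P' (B₂ (Q' x))) = 0 :=
        Submodule.inner_right_of_mem_orthogonal
          (Submodule.starProjection_apply_mem _ _) (Submodule.starProjection_apply_mem _ _)
      have h1 : ‖B x‖ ^ 2 = ‖P (B₁ (Q x))‖ ^ 2 + ‖P' (B₂ (Q' x))‖ ^ 2 := by
        have : B x = P (B₁ (Q x)) - P' (B₂ (Q' x)) := rfl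
        rw [this, norm_sub_sq_real, horth]; ring
      have h2 : ‖x‖ ^ 2 = ‖Q' x‖ ^ 2 + ‖Q x‖ ^ 2 := by
        have horth' : inner ℝ (Q' x) (Q x) = 0 :=
          Submodule.inner_right_of_mem_orthogonal
            (Submodule.starProjection_apply_mem _ _) (Submodule.starProjection_apply_mem _ _)
        conv_lhs => rw [← hQQ x]
        rw [norm_add_sq_real, horth']; ring
      have h3 : ‖P (B₁ (Q x))‖ ≤ ‖Q x‖ := (nP _).trans (hB₁ _)
      have h4 : ‖P' (B₂ (Q' x))‖ ≤ ‖Q' x‖ := (nP' _).trans (hB₂ _)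
      rw [one_mul]
      refine le_of_sq_le_sq ?_ (norm_nonneg _)
      rw [h1, h2, add_comm]
      gcongr
    have hle := hsInner_le_mul_traceNorm T' B 1 hBc
    have hT' : T' = T - D := by rw [hD]; abel
    have e1 : hsInner T (P ∘ₗ (B₁ ∘ₗ Q)) = traceNorm T := by
      rw [hsInner_comp_left hP, hsInner_comp_right hQ, ← hB₁T]
      congr 1
      ext x; simp [hPT, hTQ]
    have e2 : hsInner T (P' ∘ₗ (B₂ ∘ₗ Q')) = 0 := by
      rw [hsInner_comp_left hP', hsInner_comp_right hQ']
      have : (P' ∘ₗ T) ∘ₗ Q' = 0 := by ext x; simp [hTQ']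
      rw [this]; simp [hsInner]
    have e3 : hsInner D (P' ∘ₗ (B₂ ∘ₗ Q')) = traceNorm D2 := by
      rw [hsInner_comp_left hP', hsInner_comp_right hQ', ← hB₂D]
      rfl
    have h5 := boundP (B₁ ∘ₗ Q) fun x => (hB₁ _).trans (nQ x)
    rw [one_mul] at hle
    have e4 : hsInner T' B = traceNorm T - hsInner D (P ∘ₗ (B₁ ∘ₗ Q)) + traceNorm D2 := by
      conv_lhs => rw [hT']
      rw [hsInner_sub_left, hB, hsInner_sub_right, hsInner_sub_right, e1, e2, e3]
      ring
    linarith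

end TraceDuality

/-! ### Matrices, nuclear norm and operator norm -/

section Matrices

variable {m₁ m₂ : ℕ}

theorem matInner_eq_sum (A B : Matrix (Fin m₁) (Fin m₂) ℝ) :
    matInner A B = ∑ j, ∑ k, A j k * B j k := by
  simp [matInner, Matrix.trace, Matrix.mul_apply]

theorem matInner_eq_sum_prod (A B : Matrix (Fin m₁) (Fin m₂) ℝ) :
    matInner A B = ∑ p : Fin m₁ × Fin m₂, A p.1 p.2 * B p.1 p.2 := by
  rw [matInner_eq_sum, Fintype.sum_prod_type]

theorem frobSq_eq_sum_prod (A : Matrix (Fin m₁) (Fin m₂) ℝ) :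
    frobSq A = ∑ p : Fin m₁ × Fin m₂, A p.1 p.2 ^ 2 := by
  rw [frobSq, Fintype.sum_prod_type]

theorem frobSq_nonneg (A : Matrix (Fin m₁) (Fin m₂) ℝ) : 0 ≤ frobSq A := by
  unfold frobSq; positivity

theorem matInner_basisMatrix (p : Fin m₁ × Fin m₂) (B : Matrix (Fin m₁) (Fin m₂) ℝ) :
    matInner (basisMatrix p) B = B p.1 p.2 := by
  rw [matInner_eq_sum_prod, Finset.sum_eq_single p]
  · simp [basisMatrix]
  · rintro ⟨j, k⟩ - h
    have : ¬ (p.1 = j ∧ p.2 = k) := fun h' => h (Prod.ext h'.1.symm h'.2.symm)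
    simp [basisMatrix, this]
  · simp

theorem matInner_smul_left (c : ℝ) (A B : Matrix (Fin m₁) (Fin m₂) ℝ) :
    matInner (c • A) B = c * matInner A B := by
  simp [matInner]

theorem matInner_neg_left (A B : Matrix (Fin m₁) (Fin m₂) ℝ) :
    matInner (-A) B = -matInner A B := by
  simp [matInner]

theorem matInner_sum_left {ι : Type*} (s : Finset ι) (A : ι → Matrix (Fin m₁) (Fin m₂) ℝ)
    (B : Matrix (Fin m₁) (Fin m₂) ℝ) :
    matInner (∑ i ∈ s, A i) B = ∑ i ∈ s, matInner (A i) B := by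
  simp [matInner, Matrix.sum_mul, Matrix.trace_sum]

theorem matInner_eq_hsInner (A B : Matrix (Fin m₁) (Fin m₂) ℝ) :
    matInner A B = hsInner (Matrix.toEuclideanLin A) (Matrix.toEuclideanLin B) := by
  rw [hsInner_eq_sum (EuclideanSpace.basisFun (Fin m₂) ℝ), matInner_eq_sum, Finset.sum_comm]
  refine Finset.sum_congr rfl fun k _ => ?_
  simp [PiLp.inner_apply, Matrix.toLpLin_apply]

theorem frobSq_eq_hsInner (A : Matrix (Fin m₁) (Fin m₂) ℝ) :
    frobSq A = hsInner (Matrix.toEuclideanLin A) (Matrix.toEuclideanLin A) := by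
  rw [← matInner_eq_hsInner, matInner_eq_sum_prod, frobSq_eq_sum_prod]
  simp only [sq]

theorem nuclearNorm_eq_traceNorm (A : Matrix (Fin m₁) (Fin m₂) ℝ) :
    nuclearNorm A = traceNorm (Matrix.toEuclideanLin A) := by
  unfold nuclearNorm traceNorm
  rw [finrank_euclideanSpace_fin]

theorem nuclearNorm_nonneg (A : Matrix (Fin m₁) (Fin m₂) ℝ) : 0 ≤ nuclearNorm A := by
  rw [nuclearNorm_eq_traceNorm]; exact traceNorm_nonneg _

theorem nuclearNorm_zero : nuclearNorm (0 : Matrix (Fin m₁) (Fin m₂) ℝ) = 0 := by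
  simp [nuclearNorm]

theorem opNorm_nonneg (A : Matrix (Fin m₁) (Fin m₂) ℝ) : 0 ≤ opNorm A := norm_nonneg _

theorem opNorm_neg (A : Matrix (Fin m₁) (Fin m₂) ℝ) : opNorm (-A) = opNorm A := by
  simp [opNorm]

theorem matInner_le_opNorm_mul_nuclearNorm (A B : Matrix (Fin m₁) (Fin m₂) ℝ) :
    matInner A B ≤ opNorm A * nuclearNorm B := by
  rw [matInner_eq_hsInner, hsInner_comm, nuclearNorm_eq_traceNorm]
  exact hsInner_le_mul_traceNorm _ _ _ fun x =>
    (LinearMap.toContinuousLinearMap (Matrix.toEuclideanLin A)).le_opNorm x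

/-- `exists_traceNorm_compression` for matrices. -/
theorem exists_nuclearNorm_compression (L L' : Matrix (Fin m₁) (Fin m₂) ℝ) :
    ∃ q : ℝ, 0 ≤ q ∧
      nuclearNorm (L - L') ≤ q + 2 * √L.rank * √(frobSq (L - L')) ∧
      nuclearNorm L - nuclearNorm L' ≤ √L.rank * √(frobSq (L - L')) - q := by
  have h := exists_traceNorm_compression (Matrix.toEuclideanLin L) (Matrix.toEuclideanLin L')
  have hr : Module.finrank ℝ (Matrix.toEuclideanLin L).range = L.rank := by
    rw [Matrix.rank_eq_finrank_range_toLin L (EuclideanSpace.basisFun (Fin m₁) ℝ).toBasis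
      (EuclideanSpace.basisFun (Fin m₂) ℝ).toBasis, ← Matrix.toEuclideanLin_eq_toLin_orthonormal]
  rwa [← map_sub, ← nuclearNorm_eq_traceNorm, ← nuclearNorm_eq_traceNorm,
    ← nuclearNorm_eq_traceNorm, ← frobSq_eq_hsInner, hr] at h

/-! ### Absolute norms and their dual norms -/

theorem SupNormLE.sub {A B : Matrix (Fin m₁) (Fin m₂) ℝ} {a b : ℝ} (hA : SupNormLE A a)
    (hB : SupNormLE B b) : SupNormLE (A - B) (a + b) := fun j k => by
  rw [Matrix.sub_apply]
  exact (abs_sub _ _).trans (add_le_add (hA j k) (hB j k))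

theorem IsAbsolute.congr_abs {R : Seminorm ℝ (Matrix (Fin m₁) (Fin m₂) ℝ)} (hR : IsAbsolute R)
    {A B : Matrix (Fin m₁) (Fin m₂) ℝ} (h : ∀ j k, |A j k| = |B j k|) : R A = R B := by
  rw [hR A, hR B]
  congr 1
  ext j k
  simpa using h j k

/-- Shrinking one entry does not increase an absolute norm: the new matrix is a convex combination
of two matrices that differ from the old one by a sign. -/
theorem IsAbsolute.mono_update {R : Seminorm ℝ (Matrix (Fin m₁) (Fin m₂) ℝ)} (hR : IsAbsolute R)
    {A B : Matrix (Fin m₁) (Fin m₂) ℝ} (p : Fin m₁ × Fin m₂)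
    (hp : |A p.1 p.2| ≤ |B p.1 p.2|) (h : ∀ q, q ≠ p → A q.1 q.2 = B q.1 q.2) : R A ≤ R B := by
  obtain ⟨θ, hθ1, hθ2, hθ⟩ : ∃ θ : ℝ, -1 ≤ θ ∧ θ ≤ 1 ∧ A p.1 p.2 = θ * B p.1 p.2 := by
    by_cases hB : B p.1 p.2 = 0
    · exact ⟨0, by norm_num, by norm_num, by simpa [hB] using hp⟩
    · have h1 : |A p.1 p.2 / B p.1 p.2| ≤ 1 := by
        rw [abs_div]; exact div_le_one_of_le₀ hp (abs_nonneg _)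
      exact ⟨A p.1 p.2 / B p.1 p.2, (abs_le.1 h1).1, (abs_le.1 h1).2, by field_simp⟩
  set B' : Matrix (Fin m₁) (Fin m₂) ℝ :=
    Matrix.of fun j k => if (j, k) = p then -B j k else B j k with hB'
  have hBB' : R B' = R B := hR.congr_abs fun j k => by
    simp only [hB', Matrix.of_apply]; split_ifs <;> simp
  have hA : A = ((1 + θ) / 2) • B + ((1 - θ) / 2) • B' := by
    ext j k
    simp only [hB', Matrix.add_apply, Matrix.smul_apply, Matrix.of_apply, smul_eq_mul]
    split_ifs with hjk
    · subst hjk; simp only at hθ; rw [hθ]; ring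
    · rw [h (j, k) hjk]; ring
  have c1 : (0 : ℝ) ≤ (1 + θ) / 2 := by linarith
  have c2 : (0 : ℝ) ≤ (1 - θ) / 2 := by linarith
  calc R A ≤ R (((1 + θ) / 2) • B) + R (((1 - θ) / 2) • B') := by
        conv_lhs => rw [hA]
        exact map_add_le_add R _ _
    _ = R B := by
        rw [map_smul_eq_mul, map_smul_eq_mul, hBB', Real.norm_of_nonneg c1, Real.norm_of_nonneg c2]
        ring

theorem IsAbsolute.mono {R : Seminorm ℝ (Matrix (Fin m₁) (Fin m₂) ℝ)} (hR : IsAbsolute R)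
    {A B : Matrix (Fin m₁) (Fin m₂) ℝ} (h : ∀ j k, |A j k| ≤ |B j k|) : R A ≤ R B := by
  -- the entries are replaced one at a time
  have key : ∀ s : Finset (Fin m₁ × Fin m₂),
      R (Matrix.of fun j k => if (j, k) ∈ s then A j k else B j k) ≤ R B := by
    intro s
    induction s using Finset.induction_on with
    | empty => exact le_of_eq (congrArg R (by ext j k; simp))
    | insert p s hp ih =>
      refine (hR.mono_update p ?_ ?_).trans ih
      · simpa [hp] using h p.1 p.2
      · intro q hq
        simp [hq]
  refine le_trans (le_of_eq (congrArg R ?_)) (key Finset.univ)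
  ext j k; simp

/-- The supremum that defines the dual norm is finite: an absolute norm dominates the norm of each
single entry. -/
theorem bddAbove_dualNorm {R : Seminorm ℝ (Matrix (Fin m₁) (Fin m₂) ℝ)} (hR : IsNorm R)
    (hRabs : IsAbsolute R) (A : Matrix (Fin m₁) (Fin m₂) ℝ) :
    BddAbove {t | ∃ B, R B ≤ 1 ∧ t = matInner A B} := by
  refine ⟨∑ p : Fin m₁ × Fin m₂, |A p.1 p.2| * (R (basisMatrix p))⁻¹, ?_⟩
  rintro _ ⟨B, hB, rfl⟩
  rw [matInner_eq_sum_prod]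
  refine Finset.sum_le_sum fun p _ => (le_abs_self _).trans ?_
  rw [abs_mul]
  refine mul_le_mul_of_nonneg_left ?_ (abs_nonneg _)
  have hpos : 0 < R (basisMatrix p) := by
    refine lt_of_le_of_ne (apply_nonneg R _) fun h0 => ?_
    have := congrFun (congrFun (hR _ h0.symm) p.1) p.2
    simp [basisMatrix] at this
  have h1 : R (B p.1 p.2 • basisMatrix p) ≤ R B := hRabs.mono fun j k => by
    simp only [basisMatrix, Matrix.smul_apply, Matrix.single_apply, smul_eq_mul]
    split_ifs with h
    · simp [h.1, h.2]
    · simp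
  rw [map_smul_eq_mul, Real.norm_eq_abs] at h1
  rw [← one_div, le_div_iff₀ hpos]
  exact h1.trans hB

theorem dualNorm_nonneg {R : Seminorm ℝ (Matrix (Fin m₁) (Fin m₂) ℝ)} (hR : IsNorm R)
    (hRabs : IsAbsolute R) (A : Matrix (Fin m₁) (Fin m₂) ℝ) : 0 ≤ dualNorm R A :=
  le_csSup (bddAbove_dualNorm hR hRabs A) ⟨0, by simp, by simp [matInner]⟩

theorem matInner_le_dualNorm_mul {R : Seminorm ℝ (Matrix (Fin m₁) (Fin m₂) ℝ)} (hR : IsNorm R)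
    (hRabs : IsAbsolute R) (A B : Matrix (Fin m₁) (Fin m₂) ℝ) :
    matInner A B ≤ dualNorm R A * R B := by
  by_cases h0 : R B = 0
  · rw [hR B h0]; simp [matInner]
  have hpos : 0 < R B := lt_of_le_of_ne (apply_nonneg R _) (Ne.symm h0)
  have h : matInner A ((R B)⁻¹ • B) ≤ dualNorm R A :=
    le_csSup (bddAbove_dualNorm hR hRabs A) ⟨_, by
      rw [map_smul_eq_mul, Real.norm_of_nonneg (by positivity), inv_mul_cancel₀ h0], rfl⟩
  have e : matInner A ((R B)⁻¹ • B) = (R B)⁻¹ * matInner A B := by simp [matInner]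
  rw [e, inv_mul_le_iff₀ hpos] at h
  linarith

end Matrices

/-! ### Symmetrization and bounded differences on finite product spaces -/

section FiniteProducts

variable {V W : Type*} [Fintype V] [Fintype W]

/-- The expectation of `g(x₁, …, xₙ)` for independent `xᵢ` with `P(xᵢ = v) = q v`. With
`q = 1/2` on `ℤˣ` this is the average over `n` Rademacher signs. -/
noncomputable def prodExp (q : V → ℝ) (n : ℕ) (g : (Fin n → V) → ℝ) : ℝ :=
  ∑ x, (∏ i, q (x i)) * g x

theorem prodExp_zero (q : V → ℝ) (g : (Fin 0 → V) → ℝ) : prodExp q 0 g = g Fin.elim0 := by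
  simp only [prodExp, Finset.univ_unique, Finset.sum_singleton, Finset.univ_eq_empty,
    Finset.prod_empty, one_mul]
  exact congrArg g (Subsingleton.elim _ _)

theorem prodExp_succ (q : V → ℝ) (n : ℕ) (g : (Fin (n + 1) → V) → ℝ) :
    prodExp q (n + 1) g = ∑ v, q v * prodExp q n (fun x => g (Fin.cons v x)) := by
  unfold prodExp
  rw [← (Fin.consEquiv fun _ => V).sum_comp, Fintype.sum_prod_type]
  refine Finset.sum_congr rfl fun v _ => ?_
  rw [Finset.mul_sum]
  refine Finset.sum_congr rfl fun x _ => ?_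
  simp [Fin.consEquiv, Fin.prod_univ_succ, mul_assoc]

theorem prodExp_mono {q : V → ℝ} (hq : ∀ v, 0 ≤ q v) {n : ℕ} {g g' : (Fin n → V) → ℝ}
    (h : ∀ x, g x ≤ g' x) : prodExp q n g ≤ prodExp q n g' :=
  Finset.sum_le_sum fun x _ =>
    mul_le_mul_of_nonneg_left (h x) (Finset.prod_nonneg fun i _ => hq (x i))

theorem prodExp_mul_left (q : V → ℝ) (n : ℕ) (c : ℝ) (g : (Fin n → V) → ℝ) :
    prodExp q n (fun x => c * g x) = c * prodExp q n g := by
  unfold prodExp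
  rw [Finset.mul_sum]
  exact Finset.sum_congr rfl fun x _ => by ring

theorem prodExp_mul_right (q : V → ℝ) (n : ℕ) (c : ℝ) (g : (Fin n → V) → ℝ) :
    prodExp q n (fun x => g x * c) = prodExp q n g * c := by
  simp only [mul_comm _ c, prodExp_mul_left]

theorem sum_mul_prodExp (q : V → ℝ) (n : ℕ) (c : W → ℝ) (g : W → (Fin n → V) → ℝ) :
    ∑ w, c w * prodExp q n (g w) = prodExp q n (fun x => ∑ w, c w * g w x) := by
  simp only [prodExp, Finset.mul_sum]
  rw [Finset.sum_comm]
  exact Finset.sum_congr rfl fun x _ => Finset.sum_congr rfl fun w _ => by ring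

theorem prodExp_const {q : V → ℝ} (hq1 : ∑ v, q v = 1) (n : ℕ) (c : ℝ) :
    prodExp q n (fun _ => c) = c := by
  induction n with
  | zero => rw [prodExp_zero]
  | succ n ih => rw [prodExp_succ]; simp only [ih]; rw [← Finset.sum_mul, hq1, one_mul]

theorem prodExp_pos {q : V → ℝ} (hq : ∀ v, 0 ≤ q v) (hq1 : ∑ v, q v = 1) {n : ℕ}
    {g : (Fin n → V) → ℝ} (hg : ∀ x, 0 < g x) : 0 < prodExp q n g := by
  have hw : ∀ x : Fin n → V, 0 ≤ ∏ i, q (x i) := fun x => Finset.prod_nonneg fun i _ => hq (x i)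
  have h1 : prodExp q n (fun _ => 1) = 1 := prodExp_const hq1 n 1
  by_contra hcon
  have h0 : prodExp q n g = 0 := le_antisymm (not_lt.1 hcon)
    (Finset.sum_nonneg fun x _ => mul_nonneg (hw x) (hg x).le)
  have hz := (Finset.sum_eq_zero_iff_of_nonneg
    fun x _ => mul_nonneg (hw x) (hg x).le).1 h0
  have : prodExp q n (fun _ => 1) = 0 := Finset.sum_eq_zero fun x hx => by
    have := (mul_eq_zero.1 (hz x hx)).resolve_right (hg x).ne'
    rw [this, zero_mul]
  linarith

end FiniteProducts

section Symmetrization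

variable {V : Type*} [Fintype V] {T : Type*}

theorem bddAbove_range_add {h u : T → ℝ} (hh : BddAbove (Set.range h)) {M : ℝ}
    (hu : ∀ t, u t ≤ M) : BddAbove (Set.range fun t => h t + u t) := by
  obtain ⟨K, hK⟩ := hh
  exact ⟨K + M, by rintro _ ⟨t, rfl⟩; exact add_le_add (hK ⟨t, rfl⟩) (hu t)⟩

/-- Symmetrization and contraction in one coordinate: the centred square `E b² - b(x)²` inside a
supremum is replaced by a Rademacher multiple of `b(x)`. Convexity of the supremum gives
`±2 b(x)²`, and `b ↦ 2b²` is `4α`-Lipschitz on `[-α, α]`. -/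
theorem sum_iSup_centred_sq_le [Nonempty T] {q : V → ℝ} (hq : ∀ v, 0 ≤ q v) (hq1 : ∑ v, q v = 1)
    {b : T → V → ℝ} {α : ℝ} (hα : 0 ≤ α) (hb : ∀ t v, |b t v| ≤ α) {h : T → ℝ}
    (hh : BddAbove (Set.range h)) :
    ∑ v, q v * ⨆ t, (h t + (∑ w, q w * b t w ^ 2 - b t v ^ 2)) ≤
      ∑ v, q v * ∑ e : ℤˣ, (1 / 2 : ℝ) * ⨆ t, (h t + 4 * α * ((e : ℤ) : ℝ) * b t v) := by
  have hb1 : ∀ t v, b t v ≤ α := fun t v => (abs_le.1 (hb t v)).2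
  have hb2 : ∀ t v, -α ≤ b t v := fun t v => (abs_le.1 (hb t v)).1
  have hsq : ∀ t v, b t v ^ 2 ≤ α ^ 2 := fun t v => sq_le_sq' (hb2 t v) (hb1 t v)
  set A : V → ℝ := fun v => ⨆ t, (h t + 2 * b t v ^ 2) with hA
  set B : V → ℝ := fun v => ⨆ t, (h t + (-(2 * b t v ^ 2))) with hB
  have bA : ∀ v, BddAbove (Set.range fun t => h t + 2 * b t v ^ 2) := fun v =>
    bddAbove_range_add hh (M := 2 * α ^ 2) fun t => by linarith [hsq t v]
  have bB : ∀ v, BddAbove (Set.range fun t => h t + (-(2 * b t v ^ 2))) := fun v =>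
    bddAbove_range_add hh (M := 0) fun t => by linarith [sq_nonneg (b t v)]
  have bC : ∀ v, BddAbove (Set.range fun t => h t + 4 * α * b t v) := fun v =>
    bddAbove_range_add hh (M := 4 * α * α) fun t =>
      mul_le_mul_of_nonneg_left (hb1 t v) (by positivity)
  have bD : ∀ v, BddAbove (Set.range fun t => h t + -(4 * α * b t v)) := fun v =>
    bddAbove_range_add hh (M := 4 * α * α) fun t => by
      have := mul_le_mul_of_nonneg_left (hb2 t v) (by positivity : 0 ≤ 4 * α)
      linarith
  have step1 : ∀ v, (⨆ t, (h t + (∑ w, q w * b t w ^ 2 - b t v ^ 2)))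
      ≤ 1 / 2 * ∑ w, q w * A w + 1 / 2 * B v := by
    intro v
    refine ciSup_le fun t => ?_
    have h1 : h t + 2 * ∑ w, q w * b t w ^ 2 ≤ ∑ w, q w * A w := by
      calc h t + 2 * ∑ w, q w * b t w ^ 2 = ∑ w, q w * (h t + 2 * b t w ^ 2) := by
            simp only [mul_add, Finset.sum_add_distrib]
            rw [← Finset.sum_mul, hq1, Finset.mul_sum, one_mul]
            congr 1
            exact Finset.sum_congr rfl fun w _ => by ring
        _ ≤ _ := Finset.sum_le_sum fun w _ =>
            mul_le_mul_of_nonneg_left (le_ciSup (bA w) t) (hq w)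
    have h2 : h t + (-(2 * b t v ^ 2)) ≤ B v := le_ciSup (bB v) t
    linarith
  have step2 : ∀ v, A v + B v ≤
      (⨆ t, (h t + 4 * α * b t v)) + ⨆ t, (h t + -(4 * α * b t v)) := by
    intro v
    have key : ∀ t t', (h t + 2 * b t v ^ 2) + (h t' + (-(2 * b t' v ^ 2))) ≤
        (⨆ t, (h t + 4 * α * b t v)) + ⨆ t, (h t + -(4 * α * b t v)) := by
      intro t t'
      have hl : 2 * b t v ^ 2 - 2 * b t' v ^ 2 ≤ 4 * α * |b t v - b t' v| := by
        have e : 2 * b t v ^ 2 - 2 * b t' v ^ 2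
          = 2 * ((b t v + b t' v) * (b t v - b t' v)) := by ring
        have h3 : (b t v + b t' v) * (b t v - b t' v) ≤ (2 * α) * |b t v - b t' v| := by
          refine (le_abs_self _).trans ?_
          rw [abs_mul]
          refine mul_le_mul_of_nonneg_right (abs_le.2 ⟨?_, ?_⟩) (abs_nonneg _) <;>
            linarith [hb1 t v, hb1 t' v, hb2 t v, hb2 t' v]
        rw [e]; linarith
      have c1 := le_ciSup (bC v) t
      have c2 := le_ciSup (bC v) t'
      have d1 := le_ciSup (bD v) t
      have d2 := le_ciSup (bD v) t'
      rcases abs_cases (b t v - b t' v) with ⟨ha, -⟩ | ⟨ha, -⟩ <;> rw [ha] at hl <;> linarith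
    have h1 : A v ≤ (⨆ t, (h t + 4 * α * b t v)) + (⨆ t, (h t + -(4 * α * b t v))) - B v := by
      refine ciSup_le fun t => ?_
      have h2 : B v ≤ (⨆ t, (h t + 4 * α * b t v)) + (⨆ t, (h t + -(4 * α * b t v)))
          - (h t + 2 * b t v ^ 2) := ciSup_le fun t' => by linarith [key t t']
      linarith
    linarith
  calc ∑ v, q v * ⨆ t, (h t + (∑ w, q w * b t w ^ 2 - b t v ^ 2))
      ≤ ∑ v, q v * (1 / 2 * ∑ w, q w * A w + 1 / 2 * B v) :=
        Finset.sum_le_sum fun v _ => mul_le_mul_of_nonneg_left (step1 v) (hq v)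
    _ = ∑ v, q v * (1 / 2 * (A v + B v)) := by
        simp only [mul_add, Finset.sum_add_distrib]
        rw [← Finset.sum_mul, hq1, one_mul, Finset.mul_sum]
        congr 1
        exact Finset.sum_congr rfl fun v _ => by ring
    _ ≤ _ := Finset.sum_le_sum fun v _ => mul_le_mul_of_nonneg_left (by
        rw [← Finset.mul_sum]
        refine mul_le_mul_of_nonneg_left ((step2 v).trans (le_of_eq ?_)) (by norm_num)
        have huniv : (Finset.univ : Finset ℤˣ) = {1, -1} := rfl
        rw [huniv, Finset.sum_pair (by decide)]
        simp) (hq v)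

/-- Symmetrization and contraction for the supremum of an empirical process of squares. -/
theorem prodExp_iSup_centred_sq_le [Nonempty T] {q : V → ℝ} (hq : ∀ v, 0 ≤ q v)
    (hq1 : ∑ v, q v = 1) {b : T → V → ℝ} {α : ℝ} (hα : 0 ≤ α) (hb : ∀ t v, |b t v| ≤ α) (n : ℕ) :
    ∀ {h : T → ℝ}, BddAbove (Set.range h) →
    prodExp q n (fun x => ⨆ t, (h t + ∑ i, (∑ w, q w * b t w ^ 2 - b t (x i) ^ 2))) ≤
      prodExp q n (fun x => prodExp (fun _ : ℤˣ => (1 / 2 : ℝ)) n fun ε =>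
        ⨆ t, (h t + ∑ i, 4 * α * ((ε i : ℤ) : ℝ) * b t (x i))) := by
  induction n with
  | zero => intro h hh; simp [prodExp_zero]
  | succ n ih =>
    intro h hh
    have hsq : ∀ t v, b t v ^ 2 ≤ α ^ 2 := fun t v =>
      sq_le_sq.2 (by rw [abs_of_nonneg hα]; exact hb t v)
    have hEsq : ∀ t, ∑ w, q w * b t w ^ 2 ≤ α ^ 2 := fun t => by
      calc ∑ w, q w * b t w ^ 2 ≤ ∑ w, q w * α ^ 2 :=
            Finset.sum_le_sum fun w _ => mul_le_mul_of_nonneg_left (hsq t w) (hq w)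
        _ = α ^ 2 := by rw [← Finset.sum_mul, hq1, one_mul]
    have habs : ∀ (e : ℤˣ) t v, 4 * α * ((e : ℤ) : ℝ) * b t v ≤ 4 * α * α := by
      intro e t v
      have hb' := abs_le.1 (hb t v)
      rw [mul_assoc]
      refine mul_le_mul_of_nonneg_left ?_ (by positivity)
      rcases Int.units_eq_one_or e with rfl | rfl
      · simpa using hb'.2
      · simpa using by linarith [hb'.1]
    have hbd : ∀ (x : Fin n → V) (ε : Fin n → ℤˣ),
        BddAbove (Set.range fun t => h t + ∑ i, 4 * α * ((ε i : ℤ) : ℝ) * b t (x i)) := fun x ε =>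
      bddAbove_range_add (u := fun t => ∑ i, 4 * α * ((ε i : ℤ) : ℝ) * b t (x i)) hh
        (M := ∑ i : Fin n, 4 * α * α) fun t => Finset.sum_le_sum fun i _ => habs _ _ _
    have hbd' : ∀ v, BddAbove (Set.range fun t => h t + (∑ w, q w * b t w ^ 2 - b t v ^ 2)) :=
      fun v => bddAbove_range_add (u := fun t => ∑ w, q w * b t w ^ 2 - b t v ^ 2) hh
        (M := α ^ 2) fun t => by linarith [hEsq t, sq_nonneg (b t v)]
    calc prodExp q (n + 1) (fun x => ⨆ t, (h t + ∑ i, (∑ w, q w * b t w ^ 2 - b t (x i) ^ 2)))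
        = ∑ v, q v * prodExp q n (fun x => ⨆ t, ((h t + (∑ w, q w * b t w ^ 2 - b t v ^ 2))
            + ∑ i, (∑ w, q w * b t w ^ 2 - b t (x i) ^ 2))) := by
          rw [prodExp_succ]
          simp only [Fin.sum_univ_succ, Fin.cons_zero, Fin.cons_succ, add_assoc]
      _ ≤ ∑ v, q v * prodExp q n (fun x => prodExp (fun _ : ℤˣ => (1 / 2 : ℝ)) n fun ε =>
            ⨆ t, ((h t + (∑ w, q w * b t w ^ 2 - b t v ^ 2))
              + ∑ i, 4 * α * ((ε i : ℤ) : ℝ) * b t (x i))) :=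
          Finset.sum_le_sum fun v _ => mul_le_mul_of_nonneg_left
            (ih (h := fun t => h t + (∑ w, q w * b t w ^ 2 - b t v ^ 2)) (hbd' v)) (hq v)
      _ = prodExp q n (fun x => prodExp (fun _ : ℤˣ => (1 / 2 : ℝ)) n fun ε =>
            ∑ v, q v * ⨆ t, ((h t + ∑ i, 4 * α * ((ε i : ℤ) : ℝ) * b t (x i))
              + (∑ w, q w * b t w ^ 2 - b t v ^ 2))) := by
          rw [sum_mul_prodExp]
          simp only [sum_mul_prodExp, add_right_comm]
      _ ≤ prodExp q n (fun x => prodExp (fun _ : ℤˣ => (1 / 2 : ℝ)) n fun ε =>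
            ∑ v, q v * ∑ e : ℤˣ, (1 / 2 : ℝ) *
              ⨆ t, ((h t + ∑ i, 4 * α * ((ε i : ℤ) : ℝ) * b t (x i))
                + 4 * α * ((e : ℤ) : ℝ) * b t v)) :=
          prodExp_mono hq fun x => prodExp_mono (fun _ => by norm_num) fun ε =>
            sum_iSup_centred_sq_le hq hq1 hα hb (hbd x ε)
      _ = _ := by
          rw [prodExp_succ]
          simp only [prodExp_succ, ← sum_mul_prodExp]
          simp only [Fin.sum_univ_succ, Fin.cons_zero, Fin.cons_succ, ← add_assoc, add_right_comm]

end Symmetrization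

section BoundedDifferences

variable {V : Type*} [Fintype V] [MeasurableSpace V] [MeasurableSingletonClass V]

theorem sum_measureReal_singleton (Q : Measure V) [IsProbabilityMeasure Q] :
    ∑ v, Q.real {v} = 1 := by
  have := integral_fintype (μ := Q) (f := fun _ : V => (1 : ℝ)) .of_finite
  simp only [integral_const, probReal_univ, smul_eq_mul, mul_one] at this
  exact this.symm

/-- Hoeffding's lemma on a finite probability space. -/
theorem sum_exp_centred_le (Q : Measure V) [IsProbabilityMeasure Q] {φ : V → ℝ} {c : ℝ}
    (hφ : ∀ v w, φ v - φ w ≤ c) (l : ℝ) :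
    ∑ v, Q.real {v} * Real.exp (l * (φ v - ∑ w, Q.real {w} * φ w))
      ≤ Real.exp (l ^ 2 * c ^ 2 / 8) := by
  have : Nonempty V := by
    by_contra hV
    rw [not_nonempty_iff] at hV
    have := sum_measureReal_singleton Q
    simp at this
  obtain ⟨v₀, hv₀⟩ := Finite.exists_min φ
  have hs := hasSubgaussianMGF_of_mem_Icc (μ := Q) (X := φ) (a := φ v₀) (b := φ v₀ + c)
    (measurable_of_finite φ).aemeasurable
    (Filter.Eventually.of_forall fun v => ⟨hv₀ v, by linarith [hφ v v₀]⟩)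
  have h := hs.mgf_le l
  rw [mgf, integral_fintype .of_finite, integral_fintype .of_finite] at h
  simp only [smul_eq_mul] at h
  refine h.trans (le_of_eq ?_)
  congr 1
  simp only [add_sub_cancel_left, NNReal.coe_pow, NNReal.coe_div, coe_nnnorm, Real.norm_eq_abs,
    NNReal.coe_ofNat, div_pow, sq_abs]
  ring

/-- The exponential moment bound behind McDiarmid's inequality. -/
theorem prodExp_exp_centred_le (Q : Measure V) [IsProbabilityMeasure Q] {c : ℝ} (l : ℝ) (n : ℕ) :
    ∀ {g : (Fin n → V) → ℝ}, (∀ x i v, |g (Function.update x i v) - g x| ≤ c) →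
    prodExp (fun v => Q.real {v}) n
        (fun x => Real.exp (l * (g x - prodExp (fun v => Q.real {v}) n g)))
      ≤ Real.exp (n * (l ^ 2 * c ^ 2 / 8)) := by
  induction n with
  | zero => intro g _; simp [prodExp_zero]
  | succ n ih =>
    intro g hg
    set q : V → ℝ := fun v => Q.real {v} with hqdef
    have hq : ∀ v, 0 ≤ q v := fun v => measureReal_nonneg
    have hq1 : ∑ v, q v = 1 := sum_measureReal_singleton Q
    set φ : V → ℝ := fun v => prodExp q n (fun x => g (Fin.cons v x)) with hφ
    have hEg : prodExp q (n + 1) g = ∑ v, q v * φ v := prodExp_succ q n g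
    have hφd : ∀ v w, φ v - φ w ≤ c := by
      intro v w
      have h1 : φ v ≤ prodExp q n (fun x => c + g (Fin.cons w x)) := prodExp_mono hq fun x => by
        have := hg (Fin.cons w x) 0 v
        rw [Fin.update_cons_zero] at this
        linarith [(abs_le.1 this).2]
      have h2 : prodExp q n (fun x => c + g (Fin.cons w x)) = c + φ w := by
        have h3 := prodExp_const hq1 n c
        unfold prodExp at h3
        simp only [hφ, prodExp, mul_add, Finset.sum_add_distrib, h3]
      linarith
    calc prodExp q (n + 1) (fun x => Real.exp (l * (g x - prodExp q (n + 1) g)))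
        = ∑ v, q v * (Real.exp (l * (φ v - ∑ w, q w * φ w)) *
            prodExp q n (fun x => Real.exp (l * (g (Fin.cons v x) - φ v)))) := by
          rw [prodExp_succ, hEg]
          refine Finset.sum_congr rfl fun v _ => ?_
          congr 1
          rw [← prodExp_mul_left]
          congr 1
          funext x
          rw [← Real.exp_add]
          ring_nf
      _ ≤ ∑ v, q v * (Real.exp (l * (φ v - ∑ w, q w * φ w)) *
            Real.exp (n * (l ^ 2 * c ^ 2 / 8))) := by
          refine Finset.sum_le_sum fun v _ => mul_le_mul_of_nonneg_left
            (mul_le_mul_of_nonneg_left (ih fun x i w => ?_) (Real.exp_pos _).le) (hq v)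
          rw [Fin.cons_update]
          exact hg _ _ _
      _ = (∑ v, q v * Real.exp (l * (φ v - ∑ w, q w * φ w))) *
            Real.exp (n * (l ^ 2 * c ^ 2 / 8)) := by
          rw [Finset.sum_mul]
          exact Finset.sum_congr rfl fun v _ => by ring
      _ ≤ Real.exp (l ^ 2 * c ^ 2 / 8) * Real.exp (n * (l ^ 2 * c ^ 2 / 8)) :=
          mul_le_mul_of_nonneg_right (sum_exp_centred_le Q hφd l) (Real.exp_pos _).le
      _ = _ := by
          rw [← Real.exp_add]; push_cast; ring_nf

/-- **McDiarmid's inequality** on a finite product space. -/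
theorem prodExp_indicator_le_exp (Q : Measure V) [IsProbabilityMeasure Q] {c : ℝ} (hc : 0 < c)
    {n : ℕ} (hn : 0 < n) {g : (Fin n → V) → ℝ}
    (hg : ∀ x i v, |g (Function.update x i v) - g x| ≤ c) {u : ℝ} (hu : 0 ≤ u) :
    prodExp (fun v => Q.real {v}) n
        (Set.indicator {x | prodExp (fun v => Q.real {v}) n g + u ≤ g x} 1)
      ≤ Real.exp (-(2 * u ^ 2 / (n * c ^ 2))) := by
  have hn' : (0 : ℝ) < n := by exact_mod_cast hn
  set q : V → ℝ := fun v => Q.real {v} with hqdef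
  have hq : ∀ v, 0 ≤ q v := fun v => measureReal_nonneg
  -- the optimal parameter in the exponential Markov inequality
  set l : ℝ := 4 * u / (n * c ^ 2) with hl
  have hl0 : 0 ≤ l := by positivity
  have h1 := prodExp_exp_centred_le Q l n hg
  calc prodExp q n (Set.indicator {x | prodExp q n g + u ≤ g x} 1)
      ≤ prodExp q n (fun x => Real.exp (-(l * u)) * Real.exp (l * (g x - prodExp q n g))) := by
        refine prodExp_mono hq fun x => ?_
        rw [← Real.exp_add]
        by_cases hx : prodExp q n g + u ≤ g x
        · rw [Set.indicator_of_mem (by exact hx), Pi.one_apply]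
          refine Real.one_le_exp ?_
          have := mul_le_mul_of_nonneg_left (by linarith : u ≤ g x - prodExp q n g) hl0
          linarith
        · rw [Set.indicator_of_notMem (by exact hx)]
          exact (Real.exp_pos _).le
    _ = Real.exp (-(l * u)) * prodExp q n (fun x => Real.exp (l * (g x - prodExp q n g))) :=
        prodExp_mul_left _ _ _ _
    _ ≤ Real.exp (-(l * u)) * Real.exp (n * (l ^ 2 * c ^ 2 / 8)) :=
        mul_le_mul_of_nonneg_left h1 (Real.exp_pos _).le
    _ = _ := by
        rw [← Real.exp_add, hl]
        congr 1
        field_simp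
        ring

/-- Deviation bound for the supremum of an empirical process of squares, in terms of a bound `τ`
for the corresponding Rademacher process. -/
theorem prodExp_indicator_iSup_le {T : Type*} [Nonempty T] (Q : Measure V) [IsProbabilityMeasure Q]
    {b : T → V → ℝ} {α : ℝ} (hα : 0 < α) (hb : ∀ t v, |b t v| ≤ α) {n : ℕ} (hn : 0 < n) {τ : ℝ}
    (hτ : prodExp (fun v => Q.real {v}) n (fun x =>
      prodExp (fun _ : ℤˣ => (1 / 2 : ℝ)) n fun ε =>
        ⨆ t, ∑ i, ((ε i : ℤ) : ℝ) * b t (x i)) ≤ τ) {u : ℝ} (hu : 0 ≤ u) :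
    prodExp (fun v => Q.real {v}) n
        (Set.indicator {x | ∃ t, 4 * α * τ + u <
          ∑ i, (∑ w, Q.real {w} * b t w ^ 2 - b t (x i) ^ 2)} 1)
      ≤ Real.exp (-(2 * u ^ 2 / (n * α ^ 4))) := by
  set q : V → ℝ := fun v => Q.real {v} with hqdef
  have hq : ∀ v, 0 ≤ q v := fun v => measureReal_nonneg
  have hq1 : ∑ v, q v = 1 := sum_measureReal_singleton Q
  set S : (Fin n → V) → ℝ := fun x => ⨆ t, ∑ i, (∑ w, q w * b t w ^ 2 - b t (x i) ^ 2) with hS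
  have hsq : ∀ t v, b t v ^ 2 ≤ α ^ 2 := fun t v =>
    sq_le_sq.2 (by rw [abs_of_pos hα]; exact hb t v)
  have hEsq : ∀ t, ∑ w, q w * b t w ^ 2 ≤ α ^ 2 := fun t => by
    calc ∑ w, q w * b t w ^ 2 ≤ ∑ w, q w * α ^ 2 :=
          Finset.sum_le_sum fun w _ => mul_le_mul_of_nonneg_left (hsq t w) (hq w)
      _ = α ^ 2 := by rw [← Finset.sum_mul, hq1, one_mul]
  have hbd : ∀ x : Fin n → V,
      BddAbove (Set.range fun t => ∑ i, (∑ w, q w * b t w ^ 2 - b t (x i) ^ 2)) := by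
    intro x
    refine ⟨∑ i : Fin n, α ^ 2, ?_⟩
    rintro _ ⟨t, rfl⟩
    exact Finset.sum_le_sum fun i _ => by linarith [hEsq t, sq_nonneg (b t (x i))]
  have hES : prodExp q n S ≤ 4 * α * τ := by
    have h := prodExp_iSup_centred_sq_le hq hq1 hα.le hb n (h := fun _ : T => (0 : ℝ))
      ⟨0, by rintro _ ⟨t, rfl⟩; exact le_rfl⟩
    simp only [zero_add, mul_assoc, ← Finset.mul_sum] at h
    simp only [← Real.mul_iSup_of_nonneg hα.le, ← Real.mul_iSup_of_nonneg (zero_le_four (α := ℝ)),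
      prodExp_mul_left] at h
    refine h.trans ?_
    rw [mul_assoc]
    gcongr
  have hdiff : ∀ x i v, |S (Function.update x i v) - S x| ≤ α ^ 2 := by
    have hone : ∀ (x : Fin n → V) i v w, S (Function.update x i v)
        ≤ S (Function.update x i w) + α ^ 2 := by
      intro x i v w
      refine ciSup_le fun t => ?_
      have h1 := le_ciSup (hbd (Function.update x i w)) t
      refine le_trans ?_ (add_le_add_left h1 _)
      rw [← Finset.add_sum_erase _ _ (Finset.mem_univ i),
        ← Finset.add_sum_erase Finset.univ (fun j => _ - b t (Function.update x i w j) ^ 2)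
          (Finset.mem_univ i)]
      have h2 : ∑ j ∈ Finset.univ.erase i,
            (∑ w, q w * b t w ^ 2 - b t (Function.update x i v j) ^ 2)
          = ∑ j ∈ Finset.univ.erase i,
            (∑ w, q w * b t w ^ 2 - b t (Function.update x i w j) ^ 2) :=
        Finset.sum_congr rfl fun j hj => by
          rw [Function.update_of_ne (Finset.ne_of_mem_erase hj),
            Function.update_of_ne (Finset.ne_of_mem_erase hj)]
      rw [h2, Function.update_self, Function.update_self]
      linarith [hsq t w, sq_nonneg (b t v)]
    intro x i v
    have h1 := hone x i v (x i)
    have h2 := hone x i (x i) v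
    rw [Function.update_eq_self] at h1 h2
    exact abs_le.2 ⟨by linarith, by linarith⟩
  have hmc := prodExp_indicator_le_exp Q (by positivity : 0 < α ^ 2) hn hdiff hu
  rw [← pow_mul] at hmc
  refine le_trans (prodExp_mono hq fun x => ?_) hmc
  refine Set.indicator_le_indicator_of_subset ?_ (fun _ => zero_le_one) x
  rintro x ⟨t, ht⟩
  have := le_ciSup (hbd x) t
  simp only [Set.mem_ofPred_eq]
  exact (by linarith : prodExp q n S + u ≤ _).trans (ht.le.trans this)

end BoundedDifferences

/-! ### High-probability events -/

section Transfer

theorem integral_eq_prodExp {V : Type*} [Fintype V] [MeasurableSpace V]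
    [MeasurableSingletonClass V] {S : Type*} [MeasurableSpace S] {P : Measure S}
    [IsProbabilityMeasure P] {Q : Measure V} [IsProbabilityMeasure Q] {n : ℕ}
    {Y : Fin n → S → V} (hY : ∀ i, Measurable (Y i)) (hind : iIndepFun Y P)
    (hlaw : ∀ i, P.map (Y i) = Q) (G : (Fin n → V) → ℝ) :
    ∫ ω, G (fun i => Y i ω) ∂P = prodExp (fun v => Q.real {v}) n G := by
  have hmap : P.map (fun ω i => Y i ω) = Measure.pi fun _ => Q := by
    rw [(iIndepFun_iff_map_fun_eq_pi_map fun i => (hY i).aemeasurable).1 hind]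
    simp only [hlaw]
  have hm : Measurable fun ω i => Y i ω := measurable_pi_lambda _ hY
  rw [← integral_map (φ := fun ω i => Y i ω) hm.aemeasurable
    (measurable_of_finite G).aestronglyMeasurable, hmap, integral_fintype .of_finite]
  refine Finset.sum_congr rfl fun x _ => ?_
  simp [measureReal_def, Measure.pi_singleton, ENNReal.toReal_prod]

theorem measureReal_preimage_eq_prodExp {V : Type*} [Fintype V] [MeasurableSpace V]
    [MeasurableSingletonClass V] {S : Type*} [MeasurableSpace S] {P : Measure S}
    [IsProbabilityMeasure P] {Q : Measure V} [IsProbabilityMeasure Q] {n : ℕ}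
    {Y : Fin n → S → V} (hY : ∀ i, Measurable (Y i)) (hind : iIndepFun Y P)
    (hlaw : ∀ i, P.map (Y i) = Q) (A : Set (Fin n → V)) :
    P.real {ω | (fun i => Y i ω) ∈ A} = prodExp (fun v => Q.real {v}) n (A.indicator 1) := by
  have hm : Measurable fun ω i => Y i ω := measurable_pi_lambda _ hY
  have hA : MeasurableSet {ω | (fun i => Y i ω) ∈ A} := hm (Set.toFinite A).measurableSet
  rw [← integral_eq_prodExp hY hind hlaw, ← integral_indicator_one hA]
  rfl

/-- Averaging over `N` signs a function of `n` of them is averaging over `n` signs. -/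
theorem sum_signs_comp_eq_prodExp {n N : ℕ} {e : Fin n → Fin N} (he : Function.Injective e)
    (f : (Fin n → ℤˣ) → ℝ) :
    (∑ ε : Fin N → ℤˣ, f (fun k => ε (e k))) / 2 ^ N
      = prodExp (fun _ : ℤˣ => (1 / 2 : ℝ)) n f := by
  classical
  let p : Fin N → Prop := fun i => i ∈ Set.range e
  let e' : Fin n ≃ {i // p i} := Equiv.ofInjective e he
  have h1 : ∑ ε : Fin N → ℤˣ, f (fun k => ε (e k))
      = ∑ a : ({i // p i} → ℤˣ) × ({i // ¬ p i} → ℤˣ), f (fun k => a.1 (e' k)) := by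
    rw [← (Equiv.piEquivPiSubtypeProd p fun _ => ℤˣ).sum_comp]
    rfl
  have hcard : Fintype.card ({i // ¬ p i} → ℤˣ) = 2 ^ (N - n) := by
    rw [Fintype.card_fun, Fintype.card_units_int, Fintype.card_subtype_compl,
      ← Fintype.card_congr e', Fintype.card_fin, Fintype.card_fin]
  have hnN : n ≤ N := by simpa using Fintype.card_le_of_injective e he
  have h2 : ∑ a : {i // p i} → ℤˣ, f (fun k => a (e' k)) = ∑ ε : Fin n → ℤˣ, f ε := by
    rw [← (Equiv.arrowCongr e' (Equiv.refl ℤˣ)).sum_comp]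
    refine Finset.sum_congr rfl fun a _ => congrArg f ?_
    funext k; simp
  rw [h1, Fintype.sum_prod_type]
  simp only [Finset.sum_const, Finset.card_univ, hcard, nsmul_eq_mul]
  rw [← Finset.mul_sum, h2]
  simp only [prodExp, Finset.prod_const, Finset.card_univ, Fintype.card_fin]
  rw [← Finset.mul_sum]
  have h3 : (2 : ℝ) ^ N = 2 ^ (N - n) * 2 ^ n := by rw [← pow_add, Nat.sub_add_cancel hnN]
  rw [h3]
  rw [one_div, inv_pow]
  push_cast
  field_simp

theorem sigmaR_eq_sum_fin {m₁ m₂ N n : ℕ} {Om : Finset (Fin N)} (e : Fin n ≃ Om)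
    (x : Fin N → Fin m₁ × Fin m₂) (ε : Fin N → ℤˣ) :
    sigmaR Om x ε = (n : ℝ)⁻¹ • ∑ k, (((ε (e k) : ℤ) : ℝ)) • basisMatrix (x (e k)) := by
  have hn : Om.card = n := by simpa using (Fintype.card_congr e).symm
  rw [sigmaR, hn, ← Finset.sum_coe_sort Om, ← e.sum_comp]

end Transfer

section Events

variable {m₁ m₂ N : ℕ} {S : Type*} [MeasurableSpace S] {P : Measure S}
  {X : Fin N → S → Fin m₁ × Fin m₂} {Om : Finset (Fin N)} {Q : Measure (Fin m₁ × Fin m₂)}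

theorem expSigmaR_eq_prodExp [IsProbabilityMeasure P] [IsProbabilityMeasure Q] {n : ℕ}
    (e : Fin n ≃ Om) (hX : ∀ i, Measurable (X i))
    (hlaw : ∀ i ∈ Om, P.map (X i) = Q) (hind : iIndepFun (fun i : Om => X i) P)
    (f : Matrix (Fin m₁) (Fin m₂) ℝ → ℝ) :
    expSigmaR P Om X f = prodExp (fun v => Q.real {v}) n fun x =>
      prodExp (fun _ : ℤˣ => (1 / 2 : ℝ)) n fun ε =>
        f ((n : ℝ)⁻¹ • ∑ k, (((ε k : ℤ) : ℝ)) • basisMatrix (x k)) := by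
  have he : Function.Injective fun k => (e k : Fin N) := Subtype.val_injective.comp e.injective
  rw [← integral_eq_prodExp (Y := fun k => X (e k)) (P := P) (fun k => hX _)
    (hind.precomp e.injective) (fun k => hlaw _ (e k).2)]
  unfold expSigmaR
  refine integral_congr_ae (Filter.Eventually.of_forall fun ω => ?_)
  simp only
  rw [← sum_signs_comp_eq_prodExp he]
  simp only [sigmaR_eq_sum_fin e]

/-- With high probability, simultaneously for all matrices `B` with entries bounded by `α`, the
population second moment of `B` is controlled by its empirical counterpart. The class of all `B` is
cut into the slices `g B * E ≲ 2 ^ k`, and the failure probabilities of the slices are summable,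
so that the bound is linear in `g B`. -/
theorem exists_event_sum_sq_le [IsProbabilityMeasure P] [IsProbabilityMeasure Q]
    (hX : ∀ i, Measurable (X i)) (hOm : Om.Nonempty)
    (hlaw : ∀ i ∈ Om, P.map (X i) = Q) (hind : iIndepFun (fun i : Om => X i) P)
    {g gs : Matrix (Fin m₁) (Fin m₂) ℝ → ℝ} (hg : ∀ B, 0 ≤ g B) (hg0 : g 0 = 0)
    (hgs : ∀ A, 0 ≤ gs A) (hdual : ∀ A B, matInner A B ≤ gs A * g B) {α : ℝ} (hα : 0 ≤ α)
    (hd : (2 : ℝ) ≤ (m₁ : ℝ) + m₂) :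
    ∃ E : Set S, MeasurableSet E ∧ P.real Eᶜ ≤ 1 / ((m₁ : ℝ) + m₂) ∧ ∀ ω ∈ E,
      ∀ B : Matrix (Fin m₁) (Fin m₂) ℝ, SupNormLE B α →
        ∑ p, Q.real {p} * B p.1 p.2 ^ 2 ≤
          (Om.card : ℝ)⁻¹ * ∑ i ∈ Om, B (X i ω).1 (X i ω).2 ^ 2
            + 10 * α * (g B * expSigmaR P Om X gs)
            + 5 * α ^ 2 * √(Real.log ((m₁ : ℝ) + m₂) / Om.card) := by
  rcases hα.eq_or_lt with rfl | hα
  · refine ⟨Set.univ, MeasurableSet.univ, by simp; positivity, fun ω _ B hB => ?_⟩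
    have hB0 : ∀ j k, B j k = 0 := fun j k => abs_eq_zero.1 (le_antisymm (hB j k) (abs_nonneg _))
    simp [hB0]
  set d : ℝ := (m₁ : ℝ) + m₂ with hd'
  set n := Om.card with hn'
  let e : Fin n ≃ Om := Om.equivFin.symm
  have hn : 0 < n := hOm.card_pos
  have hnR : (0 : ℝ) < n := by exact_mod_cast hn
  set q : Fin m₁ × Fin m₂ → ℝ := fun v => Q.real {v} with hqdef
  have hq : ∀ v, 0 ≤ q v := fun v => measureReal_nonneg
  have hq1 : ∑ v, q v = 1 := sum_measureReal_singleton Q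
  set EG := expSigmaR P Om X gs with hEGdef
  have hEG := expSigmaR_eq_prodExp e hX hlaw hind gs
  rw [← hEGdef] at hEG
  have hhalf : ∀ _ : ℤˣ, (0 : ℝ) ≤ 1 / 2 := fun _ => by norm_num
  -- the value of the Rademacher average at a matrix
  have hval : ∀ (x : Fin n → Fin m₁ × Fin m₂) (ε : Fin n → ℤˣ) (B : Matrix (Fin m₁) (Fin m₂) ℝ),
      matInner ((n : ℝ)⁻¹ • ∑ k, (((ε k : ℤ) : ℝ)) • basisMatrix (x k)) B
        = (n : ℝ)⁻¹ * ∑ k, ((ε k : ℤ) : ℝ) * B (x k).1 (x k).2 := by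
    intro x ε B
    rw [matInner_smul_left, matInner_sum_left]
    simp only [matInner_smul_left, matInner_basisMatrix]
  -- the all-ones sign vector alone makes the expectation positive
  have hEGpos : 0 < EG := by
    rw [hEG]
    refine prodExp_pos hq hq1 fun x => ?_
    refine Finset.sum_pos' (fun ε _ => mul_nonneg (Finset.prod_nonneg fun _ _ => hhalf 1) (hgs _))
      ⟨fun _ => 1, Finset.mem_univ _, mul_pos (Finset.prod_pos fun _ _ => by norm_num) ?_⟩
    refine lt_of_le_of_ne (hgs _) fun h0 => ?_
    have h1 := hdual ((n : ℝ)⁻¹ • ∑ k, (((1 : ℤˣ) : ℤ) : ℝ) • basisMatrix (x k))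
      (basisMatrix (x ⟨0, hn⟩))
    rw [hval x fun _ => 1] at h1
    beta_reduce at h0
    rw [← h0, zero_mul] at h1
    have h2 : 0 < ∑ k, (((1 : ℤˣ) : ℤ) : ℝ) *
        basisMatrix (x ⟨0, hn⟩) (x k).1 (x k).2 := by
      refine Finset.sum_pos' (fun k _ => ?_) ⟨⟨0, hn⟩, Finset.mem_univ _, ?_⟩
      · simp only [basisMatrix, Matrix.single_apply]
        split_ifs <;> simp
      · simp [basisMatrix]
    have := mul_pos (inv_pos.2 hnR) h2
    linarith
  set s : ℝ := √(Real.log d / n) with hs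
  have hlogd : 0 < Real.log d := Real.log_pos (by linarith)
  have hspos : 0 < s := Real.sqrt_pos.2 (by positivity)
  have hs2 : n * s ^ 2 = Real.log d := by
    rw [hs, Real.sq_sqrt (by positivity)]; field_simp
  let T : ℕ → Type := fun k =>
    {B : Matrix (Fin m₁) (Fin m₂) ℝ // SupNormLE B α ∧ g B * EG ≤ 2 ^ k * α * s}
  have hT : ∀ k, Nonempty (T k) := fun k =>
    ⟨⟨0, fun j l => by simpa using hα.le, by rw [hg0, zero_mul]; positivity⟩⟩
  let b : ∀ k, T k → Fin m₁ × Fin m₂ → ℝ := fun k B p => B.1 p.1 p.2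
  let bad : ℕ → Set (Fin n → Fin m₁ × Fin m₂) := fun k =>
    {x | ∃ t, 4 * α * (n * (2 ^ k * α * s)) + n * α ^ 2 * 2 ^ k * s <
      ∑ i, (∑ w, q w * b k t w ^ 2 - b k t (x i) ^ 2)}
  have hbad : ∀ k, P.real {ω | (fun i => X (e i) ω) ∈ bad k} ≤ 1 / d / 2 / 2 ^ k := by
    intro k
    have := hT k
    have hτ : prodExp q n (fun x => prodExp (fun _ : ℤˣ => (1 / 2 : ℝ)) n fun ε =>
        ⨆ t, ∑ i, ((ε i : ℤ) : ℝ) * b k t (x i)) ≤ n * (2 ^ k * α * s) := by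
      calc _ ≤ prodExp q n (fun x => prodExp (fun _ : ℤˣ => (1 / 2 : ℝ)) n fun ε =>
            gs ((n : ℝ)⁻¹ • ∑ k, (((ε k : ℤ) : ℝ)) • basisMatrix (x k))
              * (n * (2 ^ k * α * s / EG))) := by
            refine prodExp_mono hq fun x => prodExp_mono hhalf fun ε => ciSup_le fun t => ?_
            have h1 := hdual ((n : ℝ)⁻¹ • ∑ k, (((ε k : ℤ) : ℝ)) • basisMatrix (x k)) t.1
            rw [hval, inv_mul_le_iff₀ hnR] at h1
            refine h1.trans ?_
            have h2 : g t.1 ≤ 2 ^ k * α * s / EG := (le_div_iff₀ hEGpos).2 t.2.2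
            have h3 := mul_le_mul_of_nonneg_left h2
              (hgs ((n : ℝ)⁻¹ • ∑ k, (((ε k : ℤ) : ℝ)) • basisMatrix (x k)))
            have h4 := mul_le_mul_of_nonneg_left h3 hnR.le
            linarith
        _ = EG * (n * (2 ^ k * α * s / EG)) := by
            simp only [prodExp_mul_right]
            rw [← hEG]
        _ = _ := by field_simp
    have h := prodExp_indicator_iSup_le Q (b := b k) hα (fun t v => t.2.1 _ _) hn hτ
      (u := n * α ^ 2 * 2 ^ k * s) (by positivity)
    rw [← measureReal_preimage_eq_prodExp (Y := fun i => X (e i)) (P := P) (fun i => hX _)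
      (hind.precomp e.injective) (fun i => hlaw _ (e i).2)] at h
    refine h.trans ?_
    have e1 : 2 * (n * α ^ 2 * 2 ^ k * s) ^ 2 / (n * α ^ 4) = 2 * 4 ^ k * Real.log d := by
      rw [← hs2, show (4 : ℝ) ^ k = 2 ^ k * 2 ^ k by rw [← mul_pow]; norm_num]
      field_simp
    have e2 : 1 / d / 2 / 2 ^ k = Real.exp (-(Real.log d + (k + 1) * Real.log 2)) := by
      rw [Real.exp_neg, Real.exp_add, Real.exp_log (by linarith), ← Nat.cast_add_one,
        Real.exp_nat_mul, Real.exp_log (by norm_num), pow_succ]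
      field_simp
    rw [e1, e2]
    refine Real.exp_le_exp.2 (neg_le_neg ?_)
    have h4 : (1 : ℝ) + k * 3 ≤ 4 ^ k := by
      have := one_add_mul_le_pow (a := (3 : ℝ)) (by norm_num) k
      norm_num at this; linarith
    have hlog : Real.log 2 ≤ Real.log d := Real.log_le_log (by norm_num) hd
    have hk0 : (0 : ℝ) ≤ k := Nat.cast_nonneg k
    have h5 : ((k : ℝ) + 1) * Real.log 2 ≤ (k + 1) * Real.log d :=
      mul_le_mul_of_nonneg_left hlog (by positivity)
    have h6 := mul_le_mul_of_nonneg_right h4 hlogd.le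
    have h7 := mul_nonneg hk0 hlogd.le
    linarith
  have hmeas : ∀ k, MeasurableSet {ω | (fun i => X (e i) ω) ∈ bad k} := fun k =>
    (measurable_pi_lambda _ fun i => hX (e i)) (Set.toFinite (bad k)).measurableSet
  refine ⟨(⋃ k, {ω | (fun i => X (e i) ω) ∈ bad k})ᶜ, (MeasurableSet.iUnion hmeas).compl, ?_, ?_⟩
  · rw [compl_compl]
    refine ENNReal.toReal_le_of_le_ofReal (by positivity) ?_
    calc P (⋃ k, {ω | (fun i => X (e i) ω) ∈ bad k})
        ≤ ∑' k, P {ω | (fun i => X (e i) ω) ∈ bad k} := measure_iUnion_le _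
      _ ≤ ∑' k : ℕ, ENNReal.ofReal (1 / d / 2 / 2 ^ k) := by
          refine ENNReal.tsum_le_tsum fun k => ?_
          rw [← ofReal_measureReal]
          exact ENNReal.ofReal_le_ofReal (hbad k)
      _ = ENNReal.ofReal (1 / d) := by
          rw [← ENNReal.ofReal_tsum_of_nonneg (fun k => by positivity) (summable_geometric_two' _),
            tsum_geometric_two']
  · intro ω hω B hB
    set t := g B * EG with ht
    have ht0 : 0 ≤ t := mul_nonneg (hg B) hEGpos.le
    -- the slice that contains `B`
    obtain ⟨k, hk1, hk2⟩ : ∃ k : ℕ, t ≤ 2 ^ k * α * s ∧ 2 ^ k * α * s ≤ 2 * t + α * s := by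
      have hex : ∃ k : ℕ, t ≤ 2 ^ k * α * s := by
        obtain ⟨k, hk⟩ := pow_unbounded_of_one_lt (t / (α * s)) (one_lt_two (α := ℝ))
        refine ⟨k, ?_⟩
        rw [mul_assoc]
        exact ((div_lt_iff₀ (by positivity)).1 hk).le
      classical
      refine ⟨Nat.find hex, Nat.find_spec hex, ?_⟩
      rcases Nat.eq_zero_or_pos (Nat.find hex) with h0 | h0
      · rw [h0]; linarith
      · have h1 := Nat.find_min hex (Nat.sub_lt h0 one_pos)
        have h2 : (2 : ℝ) ^ Nat.find hex = 2 ^ (Nat.find hex - 1) * 2 := by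
          rw [← pow_succ, Nat.sub_add_cancel h0]
        rw [h2]
        have := mul_pos hα hspos
        linarith [not_le.1 h1]
    have hnb : (fun i => X (e i) ω) ∉ bad k := fun hmem =>
      hω (Set.mem_iUnion.2 ⟨k, hmem⟩)
    have h1 : ∑ i, (∑ w, q w * B w.1 w.2 ^ 2 - B (X (e i) ω).1 (X (e i) ω).2 ^ 2)
        ≤ 4 * α * (n * (2 ^ k * α * s)) + n * α ^ 2 * 2 ^ k * s :=
      not_lt.1 fun hlt => hnb ⟨⟨B, hB, hk1⟩, hlt⟩
    rw [Finset.sum_sub_distrib, Finset.sum_const, Finset.card_univ, Fintype.card_fin,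
      nsmul_eq_mul] at h1
    have h2 : ∑ i, B (X (e i) ω).1 (X (e i) ω).2 ^ 2 = ∑ i ∈ Om, B (X i ω).1 (X i ω).2 ^ 2 := by
      rw [← Finset.sum_coe_sort Om, ← e.sum_comp]
    rw [h2] at h1
    have h3 : (n : ℝ) * (5 * α) * (2 ^ k * α * s) ≤ n * (5 * α) * (2 * t + α * s) := by
      gcongr
    have h4 : (n : ℝ) * ∑ w, q w * B w.1 w.2 ^ 2 ≤
        n * ((n : ℝ)⁻¹ * ∑ i ∈ Om, B (X i ω).1 (X i ω).2 ^ 2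
          + 10 * α * t + 5 * α ^ 2 * s) := by
      have e3 : (n : ℝ) * ((n : ℝ)⁻¹ * ∑ i ∈ Om, B (X i ω).1 (X i ω).2 ^ 2
          + 10 * α * t + 5 * α ^ 2 * s)
        = ∑ i ∈ Om, B (X i ω).1 (X i ω).2 ^ 2 + n * (10 * α * t + 5 * α ^ 2 * s) := by
        rw [add_assoc, mul_add, mul_inv_cancel_left₀ hnR.ne']
      rw [e3]
      linarith
    exact le_of_mul_le_mul_left h4 hnR

/-- With high probability, the squares of the corrupted noise variables are of order
`σ² log d` on average. -/
theorem exists_event_sum_noise_sq_le {ξ : Fin N → S → ℝ} (hξ : ∀ i, Measurable (ξ i)) {σ c₁ : ℝ}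
    (hσ : 0 < σ) (hc₁ : 0 < c₁)
    (hsub : ∀ i, Integrable (fun ω => Real.exp (ξ i ω ^ 2 / σ ^ 2)) P ∧
        ∫ ω, Real.exp (ξ i ω ^ 2 / σ ^ 2) ∂P < c₁) (s : Finset (Fin N)) {d : ℝ} (hd : 0 < d) :
    ∃ E : Set S, MeasurableSet E ∧ P.real Eᶜ ≤ 1 / d ∧ ∀ ω ∈ E,
      ∑ i ∈ s, ξ i ω ^ 2 ≤ s.card * (σ ^ 2 * (Real.log c₁ + Real.log d)) := by
  rcases s.eq_empty_or_nonempty with rfl | hs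
  · exact ⟨Set.univ, MeasurableSet.univ, by simp; positivity, fun ω _ => by simp⟩
  have hcard : (0 : ℝ) < s.card := by exact_mod_cast hs.card_pos
  set F : S → ℝ := fun ω => ∑ i ∈ s, Real.exp (ξ i ω ^ 2 / σ ^ 2) with hF
  have hFm : Measurable F := by fun_prop
  refine ⟨{ω | s.card * (c₁ * d) ≤ F ω}ᶜ, (measurableSet_le measurable_const hFm).compl, ?_, ?_⟩
  · rw [compl_compl]
    have hint : ∫ ω, F ω ∂P ≤ s.card * c₁ := by
      rw [hF, integral_finsetSum _ fun i _ => (hsub i).1, ← nsmul_eq_mul]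
      exact Finset.sum_le_card_nsmul _ _ _ fun i _ => (hsub i).2.le
    have hmk := mul_meas_ge_le_integral_of_nonneg (μ := P) (f := F)
      (Filter.Eventually.of_forall fun ω => Finset.sum_nonneg fun i _ => (Real.exp_pos _).le)
      (integrable_finsetSum _ fun i _ => (hsub i).1) (s.card * (c₁ * d))
    have h1 := hmk.trans hint
    rw [le_div_iff₀ hd]
    have h2 : (s.card * c₁) * (P.real {ω | s.card * (c₁ * d) ≤ F ω} * d) ≤ (s.card * c₁) * 1 := by
      calc _ = s.card * (c₁ * d) * P.real {ω | s.card * (c₁ * d) ≤ F ω} := by ring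
        _ ≤ _ := by rw [mul_one]; exact h1
    exact le_of_mul_le_mul_left h2 (by positivity)
  · intro ω hω
    have hω' : F ω < s.card * (c₁ * d) := not_le.1 hω
    have hJ := convexOn_exp.map_sum_le (t := s) (w := fun _ => (s.card : ℝ)⁻¹)
      (p := fun i => ξ i ω ^ 2 / σ ^ 2) (fun i _ => by positivity)
      (by rw [Finset.sum_const, nsmul_eq_mul]; field_simp) (fun i _ => Set.mem_univ _)
    simp only [smul_eq_mul] at hJ
    rw [← Finset.mul_sum, ← Finset.mul_sum, ← Finset.sum_div] at hJ
    have h1 : Real.exp ((s.card : ℝ)⁻¹ * ((∑ i ∈ s, ξ i ω ^ 2) / σ ^ 2)) ≤ c₁ * d := by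
      refine hJ.trans ?_
      rw [inv_mul_le_iff₀ hcard]
      exact hω'.le
    have h2 := (Real.le_log_iff_exp_le (by positivity)).2 h1
    rw [Real.log_mul hc₁.ne' hd.ne', inv_mul_le_iff₀ hcard, div_le_iff₀ (by positivity)] at h2
    linarith

end Events

/-! ### Basic inequalities for the minimiser -/

section Deterministic

variable {m₁ m₂ N : ℕ}

theorem trace_transpose_basisMatrix_mul (p : Fin m₁ × Fin m₂) (B : Matrix (Fin m₁) (Fin m₂) ℝ) :
    ((basisMatrix p).transpose * B).trace = B p.1 p.2 := by
  rw [Matrix.trace_mul_comm, ← matInner_basisMatrix p B, matInner, ← Matrix.trace_transpose]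
  simp

theorem card_mul_matInner_sigmaTerm (hN : 0 < N) (Om : Finset (Fin N))
    (x : Fin N → Fin m₁ × Fin m₂) (ξ : Fin N → ℝ) (B : Matrix (Fin m₁) (Fin m₂) ℝ) :
    N * matInner (sigmaTerm Om x ξ) B = ∑ i ∈ Om, ξ i * B (x i).1 (x i).2 := by
  have : (N : ℝ) ≠ 0 := by positivity
  rw [sigmaTerm, matInner_smul_left, mul_inv_cancel_left₀ this, matInner_sum_left]
  simp only [matInner_smul_left, matInner_basisMatrix]

theorem card_mul_matInner_wTerm (hN : 0 < N) (Om : Finset (Fin N))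
    (x : Fin N → Fin m₁ × Fin m₂) (B : Matrix (Fin m₁) (Fin m₂) ℝ) :
    N * matInner (wTerm Om x) B = ∑ i ∈ Om, B (x i).1 (x i).2 := by
  have : (N : ℝ) ≠ 0 := by positivity
  rw [wTerm, matInner_smul_left, mul_inv_cancel_left₀ this, matInner_sum_left]
  simp only [matInner_basisMatrix]

/-- The objective function, multiplied by `N`, in terms of the residuals. -/
theorem card_mul_objective (hN : 0 < N) (R : Seminorm ℝ (Matrix (Fin m₁) (Fin m₂) ℝ)) (l₁ l₂ : ℝ)
    (x : Fin N → Fin m₁ × Fin m₂) (y : Fin N → ℝ) (Om : Finset (Fin N))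
    (L S : Matrix (Fin m₁) (Fin m₂) ℝ) :
    N * objective R l₁ l₂ x y L S =
      (∑ i ∈ Om, (y i - (L + S) (x i).1 (x i).2) ^ 2
        + ∑ i ∈ Omᶜ, (y i - (L + S) (x i).1 (x i).2) ^ 2)
        + N * (l₁ * nuclearNorm L + l₂ * R S) := by
  have : (N : ℝ) ≠ 0 := by positivity
  rw [objective, add_assoc, mul_add, mul_inv_cancel_left₀ this, Finset.sum_add_sum_compl]
  simp only [matInner_basisMatrix]

theorem restrict_apply_of_mem {I : Finset (Fin m₁ × Fin m₂)} {p : Fin m₁ × Fin m₂} (hp : p ∈ I)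
    (B : Matrix (Fin m₁) (Fin m₂) ℝ) : restrict I B p.1 p.2 = B p.1 p.2 := by
  simp [restrict, hp]

theorem SupNormLE.restrict {B : Matrix (Fin m₁) (Fin m₂) ℝ} {a : ℝ} (ha : 0 ≤ a)
    (hB : SupNormLE B a) (I : Finset (Fin m₁ × Fin m₂)) : SupNormLE (restrict I B) a := by
  intro j k
  simp only [RobustCompletion.restrict, Matrix.of_apply]
  split_ifs
  · exact hB j k
  · simpa using ha

/-- The regularizer of a matrix that is supported in `J` and has entries bounded by `a`. -/
theorem IsAbsolute.le_mul_onesOn {R : Seminorm ℝ (Matrix (Fin m₁) (Fin m₂) ℝ)} (hR : IsAbsolute R)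
    {S : Matrix (Fin m₁) (Fin m₂) ℝ} {a : ℝ} (ha : 0 ≤ a) (hS : SupNormLE S a)
    {J : Finset (Fin m₁ × Fin m₂)} (hJ : ∀ j k, (j, k) ∉ J → S j k = 0) :
    R S ≤ a * R (onesOn J) := by
  rw [← Real.norm_of_nonneg ha, ← map_smul_eq_mul]
  refine hR.mono fun j k => ?_
  simp only [onesOn, RobustCompletion.restrict, Matrix.smul_apply, Matrix.of_apply, smul_eq_mul]
  split_ifs with h
  · simpa [abs_of_nonneg ha] using hS j k
  · simp [hJ j k h]

section BasicInequalities

variable {R : Seminorm ℝ (Matrix (Fin m₁) (Fin m₂) ℝ)} {I : Finset (Fin m₁ × Fin m₂)}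
  {L₀ S₀ L S : Matrix (Fin m₁) (Fin m₂) ℝ} {a l₁ l₂ : ℝ} {Om : Finset (Fin N)}
  {x : Fin N → Fin m₁ × Fin m₂} {ξ y : Fin N → ℝ}

/-- The noise acts on the part of the sparse component in `I` through the dual norm. -/
theorem sum_noise_mul_le (hN : 0 < N) (hR : IsNorm R) (hRabs : IsAbsolute R)
    (hx : ∀ i ∈ Om, x i ∈ I) (S : Matrix (Fin m₁) (Fin m₂) ℝ) :
    ∑ i ∈ Om, ξ i * S (x i).1 (x i).2
      ≤ N * (dualNorm R (sigmaTerm Om x ξ) * R (restrict I S)) := by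
  have h := card_mul_matInner_sigmaTerm hN Om x ξ (restrict I S)
  rw [Finset.sum_congr rfl fun i hi => by rw [restrict_apply_of_mem (hx i hi)]] at h
  rw [← h]
  exact mul_le_mul_of_nonneg_left (matInner_le_dualNorm_mul hR hRabs _ _) (Nat.cast_nonneg N)

theorem sum_abs_le (hN : 0 < N) (hR : IsNorm R) (hRabs : IsAbsolute R)
    (hx : ∀ i ∈ Om, x i ∈ I) (S : Matrix (Fin m₁) (Fin m₂) ℝ) :
    ∑ i ∈ Om, |S (x i).1 (x i).2| ≤ N * (dualNorm R (wTerm Om x) * R (restrict I S)) := by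
  have h := card_mul_matInner_wTerm hN Om x ((restrict I S).map fun t => |t|)
  simp only [Matrix.map_apply] at h
  rw [Finset.sum_congr rfl fun i hi => by rw [restrict_apply_of_mem (hx i hi)]] at h
  rw [← h, hRabs (restrict I S)]
  exact mul_le_mul_of_nonneg_left (matInner_le_dualNorm_mul hR hRabs _ _) (Nat.cast_nonneg N)

/-- The basic inequality for the sparse component: the minimiser is compared with `(L, S₀)`. -/
theorem sum_sq_sparse_le (hN : 0 < N) (hR : IsNorm R) (hRabs : IsAbsolute R)
    (hRdec : IsDecomposable R I) (hy : ∀ i, y i = (L₀ + S₀) (x i).1 (x i).2 + ξ i)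
    (ha : 0 ≤ a) (hL₀ : SupNormLE L₀ a) (hS₀ : SupNormLE S₀ a)
    (hS₀I : ∀ j k, (j, k) ∈ I → S₀ j k = 0) (hx : ∀ i ∈ Om, x i ∈ I) (hl₂ : 0 < l₂)
    (hl : 4 * (dualNorm R (sigmaTerm Om x ξ) + 2 * a * dualNorm R (wTerm Om x)) ≤ l₂)
    (hest : IsEstimator R a l₁ l₂ x y L S) :
    ∑ i ∈ Om, S (x i).1 (x i).2 ^ 2 + N * (l₂ / 2 * R (restrict I S))
      ≤ N * (l₂ * R S₀) + ∑ i ∈ Omᶜ, (8 * a ^ 2 + 2 * ξ i ^ 2) := by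
  have hopt := mul_le_mul_of_nonneg_left (hest.2.2 L S₀ hest.1 hS₀) (Nat.cast_nonneg (α := ℝ) N)
  rw [card_mul_objective hN R l₁ l₂ x y Om, card_mul_objective hN R l₁ l₂ x y Om] at hopt
  have hΔ : ∀ j k, |L₀ j k - L j k| ≤ 2 * a := fun j k => by
    have := hL₀.sub hest.1 j k
    rw [Matrix.sub_apply] at this
    linarith
  have e1 : ∑ i ∈ Om, (y i - (L + S) (x i).1 (x i).2) ^ 2
      = ∑ i ∈ Om, (y i - (L + S₀) (x i).1 (x i).2) ^ 2 + ∑ i ∈ Om, S (x i).1 (x i).2 ^ 2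
        - 2 * ∑ i ∈ Om, ξ i * S (x i).1 (x i).2
        - 2 * ∑ i ∈ Om, (L₀ (x i).1 (x i).2 - L (x i).1 (x i).2) * S (x i).1 (x i).2 := by
    rw [Finset.mul_sum, Finset.mul_sum, ← Finset.sum_add_distrib, ← Finset.sum_sub_distrib,
      ← Finset.sum_sub_distrib]
    refine Finset.sum_congr rfl fun i hi => ?_
    have h0 : S₀ (x i).1 (x i).2 = 0 := hS₀I _ _ (hx i hi)
    simp only [hy, Matrix.add_apply, h0]
    ring
  have h1 := sum_noise_mul_le (ξ := ξ) hN hR hRabs hx S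
  have h2 : ∑ i ∈ Om, (L₀ (x i).1 (x i).2 - L (x i).1 (x i).2) * S (x i).1 (x i).2
      ≤ 2 * a * (N * (dualNorm R (wTerm Om x) * R (restrict I S))) := by
    refine le_trans ?_ (mul_le_mul_of_nonneg_left (sum_abs_le hN hR hRabs hx S)
      (by positivity : 0 ≤ 2 * a))
    rw [Finset.mul_sum]
    refine Finset.sum_le_sum fun i _ => (le_abs_self _).trans ?_
    rw [abs_mul]
    exact mul_le_mul_of_nonneg_right (hΔ _ _) (abs_nonneg _)
  have h3 : 0 ≤ ∑ i ∈ Omᶜ, (y i - (L + S) (x i).1 (x i).2) ^ 2 :=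
    Finset.sum_nonneg fun i _ => sq_nonneg _
  have h4 : ∑ i ∈ Omᶜ, (y i - (L + S₀) (x i).1 (x i).2) ^ 2
      ≤ ∑ i ∈ Omᶜ, (8 * a ^ 2 + 2 * ξ i ^ 2) := by
    refine Finset.sum_le_sum fun i _ => ?_
    have e : y i - (L + S₀) (x i).1 (x i).2
        = (L₀ (x i).1 (x i).2 - L (x i).1 (x i).2) + ξ i := by
      simp only [hy, Matrix.add_apply]; ring
    have h5 : (L₀ (x i).1 (x i).2 - L (x i).1 (x i).2) ^ 2 ≤ (2 * a) ^ 2 :=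
      sq_le_sq.2 ((hΔ _ _).trans (le_abs_self _))
    rw [e]
    refine (add_sq_le).trans ?_
    linarith
  have h6 : R (restrict I S) ≤ R S := by
    rw [hRdec S]; linarith [apply_nonneg R (restrict Iᶜ S)]
  have hN0 : (0 : ℝ) ≤ N := Nat.cast_nonneg N
  have h7 := mul_le_mul_of_nonneg_left (mul_le_mul_of_nonneg_left h6 hl₂.le) hN0
  have h8 := mul_le_mul_of_nonneg_left
    (mul_le_mul_of_nonneg_right hl (apply_nonneg R (restrict I S))) hN0
  rw [e1] at hopt
  linarith

/-- The basic inequality for the low-rank component: the minimiser is compared with `(L₀, S₀)`. -/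
theorem sum_sq_add_le (hN : 0 < N) (hR : IsNorm R) (hRabs : IsAbsolute R)
    (hRdec : IsDecomposable R I) (hy : ∀ i, y i = (L₀ + S₀) (x i).1 (x i).2 + ξ i)
    (ha : 0 ≤ a) (hL₀ : SupNormLE L₀ a) (hS₀ : SupNormLE S₀ a)
    (hS₀I : ∀ j k, (j, k) ∈ I → S₀ j k = 0) (hx : ∀ i ∈ Om, x i ∈ I) (hl₂ : 0 < l₂)
    (hl₁ : 4 * opNorm (sigmaTerm Om x ξ) < l₁)
    (hl : 4 * (dualNorm R (sigmaTerm Om x ξ) + 2 * a * dualNorm R (wTerm Om x)) ≤ l₂)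
    (hest : IsEstimator R a l₁ l₂ x y L S) :
    ∑ i ∈ Om, (L₀ (x i).1 (x i).2 - L (x i).1 (x i).2 - S (x i).1 (x i).2) ^ 2
      ≤ N * (l₁ * (nuclearNorm (L₀ - L) / 2 + (nuclearNorm L₀ - nuclearNorm L)))
        + N * (l₂ * R S₀) + ∑ i ∈ Omᶜ, ξ i ^ 2 := by
  have hopt := mul_le_mul_of_nonneg_left (hest.2.2 L₀ S₀ hL₀ hS₀) (Nat.cast_nonneg (α := ℝ) N)
  rw [card_mul_objective hN R l₁ l₂ x y Om, card_mul_objective hN R l₁ l₂ x y Om] at hopt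
  have hres : ∀ i, y i - (L₀ + S₀) (x i).1 (x i).2 = ξ i := fun i => by rw [hy]; ring
  simp only [hres] at hopt
  have e1 : ∑ i ∈ Om, (y i - (L + S) (x i).1 (x i).2) ^ 2
      = ∑ i ∈ Om, (L₀ (x i).1 (x i).2 - L (x i).1 (x i).2 - S (x i).1 (x i).2) ^ 2
        + 2 * ∑ i ∈ Om, ξ i * (L₀ - L) (x i).1 (x i).2
        - 2 * ∑ i ∈ Om, ξ i * S (x i).1 (x i).2 + ∑ i ∈ Om, ξ i ^ 2 := by
    rw [Finset.mul_sum, Finset.mul_sum, ← Finset.sum_add_distrib, ← Finset.sum_sub_distrib,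
      ← Finset.sum_add_distrib]
    refine Finset.sum_congr rfl fun i hi => ?_
    have h0 : S₀ (x i).1 (x i).2 = 0 := hS₀I _ _ (hx i hi)
    simp only [hy, Matrix.add_apply, Matrix.sub_apply, h0]
    ring
  have h1 := sum_noise_mul_le (ξ := ξ) hN hR hRabs hx S
  have hN0 : (0 : ℝ) ≤ N := Nat.cast_nonneg N
  have h2 : -∑ i ∈ Om, ξ i * (L₀ - L) (x i).1 (x i).2
      ≤ N * (opNorm (sigmaTerm Om x ξ) * nuclearNorm (L₀ - L)) := by
    rw [← card_mul_matInner_sigmaTerm hN, ← mul_neg, ← matInner_neg_left, ← opNorm_neg]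
    exact mul_le_mul_of_nonneg_left (matInner_le_opNorm_mul_nuclearNorm _ _) hN0
  have h3 : 0 ≤ ∑ i ∈ Omᶜ, (y i - (L + S) (x i).1 (x i).2) ^ 2 :=
    Finset.sum_nonneg fun i _ => sq_nonneg _
  have h6 : R (restrict I S) ≤ R S := by
    rw [hRdec S]; linarith [apply_nonneg R (restrict Iᶜ S)]
  have h7 := mul_le_mul_of_nonneg_left (mul_le_mul_of_nonneg_left h6 hl₂.le) hN0
  have h8 := mul_le_mul_of_nonneg_left
    (mul_le_mul_of_nonneg_right hl (apply_nonneg R (restrict I S))) hN0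
  have h9 := mul_le_mul_of_nonneg_left
    (mul_le_mul_of_nonneg_right hl₁.le (nuclearNorm_nonneg (L₀ - L))) hN0
  have h10 : 0 ≤ N * (a * dualNorm R (wTerm Om x) * R (restrict I S)) :=
    mul_nonneg hN0 (mul_nonneg (mul_nonneg ha (dualNorm_nonneg hR hRabs _)) (apply_nonneg R _))
  have h11 : 0 ≤ N * (l₂ * R (restrict I S)) :=
    mul_nonneg hN0 (mul_nonneg hl₂.le (apply_nonneg R _))
  rw [e1] at hopt
  linarith

end BasicInequalities

/-- The part of the Frobenius norm in `I`, under the lower bound on the sampling distribution. -/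
theorem sum_sq_le_mul_sum_measure {Q : Measure (Fin m₁ × Fin m₂)}
    {I : Finset (Fin m₁ × Fin m₂)} (hI : I.Nonempty) {μ : ℝ} (hμ : 1 ≤ μ)
    (hQ : ∀ p ∈ I, (μ * (I.card : ℝ))⁻¹ ≤ Q.real {p}) (B : Matrix (Fin m₁) (Fin m₂) ℝ) :
    ∑ p ∈ I, B p.1 p.2 ^ 2 ≤ I.card * (μ * ∑ p, Q.real {p} * B p.1 p.2 ^ 2) := by
  have hc : (0 : ℝ) < μ * I.card :=
    mul_pos (by linarith) (by exact_mod_cast hI.card_pos)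
  have h : (μ * (I.card : ℝ))⁻¹ * ∑ p ∈ I, B p.1 p.2 ^ 2 ≤ ∑ p, Q.real {p} * B p.1 p.2 ^ 2 := by
    rw [Finset.mul_sum]
    refine le_trans (Finset.sum_le_sum fun p hp =>
      mul_le_mul_of_nonneg_right (hQ p hp) (sq_nonneg _)) ?_
    exact Finset.sum_le_univ_sum_of_nonneg fun p => mul_nonneg measureReal_nonneg (sq_nonneg _)
  rw [inv_mul_le_iff₀ hc] at h
  linarith

theorem frobSq_le_sum_add {I : Finset (Fin m₁ × Fin m₂)} {B : Matrix (Fin m₁) (Fin m₂) ℝ} {a : ℝ}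
    (hB : SupNormLE B (a + a)) :
    frobSq B ≤ ∑ p ∈ I, B p.1 p.2 ^ 2 + 4 * a ^ 2 * Iᶜ.card := by
  rw [frobSq_eq_sum_prod, ← Finset.sum_add_sum_compl I]
  refine add_le_add_right ?_ _
  rw [mul_comm, ← nsmul_eq_mul]
  refine Finset.sum_le_card_nsmul _ _ _ fun p _ => ?_
  have : B p.1 p.2 ^ 2 ≤ (a + a) ^ 2 := sq_le_sq.2 ((hB _ _).trans (le_abs_self _))
  linarith

theorem frobSq_restrict (I : Finset (Fin m₁ × Fin m₂)) (B : Matrix (Fin m₁) (Fin m₂) ℝ) :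
    frobSq (restrict I B) = ∑ p ∈ I, B p.1 p.2 ^ 2 := by
  rw [frobSq_eq_sum_prod, ← Finset.sum_add_sum_compl I]
  have h1 : ∑ p ∈ Iᶜ, restrict I B p.1 p.2 ^ 2 = 0 := Finset.sum_eq_zero fun p hp => by
    have : p ∉ I := Finset.mem_compl.1 hp
    simp [restrict, this]
  rw [h1, add_zero]
  exact Finset.sum_congr rfl fun p hp => by rw [restrict_apply_of_mem hp]

end Deterministic

/-! ### From the basic inequalities to error bounds -/

section ErrorBounds

/-- The error of the sparse component, from the basic inequality for it (`hbasic`) and the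
concentration bound (`hconc`). Here `SS` and `PS` are its empirical and population second moments,
`ρ` is its regularizer, and `Z` stands for the contribution of the corrupted observations. -/
theorem sparse_error_le {n N μ a s l₂ RId ED K Z SS PS ρ : ℝ} (hn : 0 < n) (hN : 0 < N)
    (hμ : 1 ≤ μ) (ha : 0 ≤ a) (hs : 0 ≤ s) (hl₂ : 0 < l₂) (hRId : 0 ≤ RId) (hED : 0 ≤ ED)
    (hK : 1 ≤ K) (hZ : 0 ≤ Z) (hSS : 0 ≤ SS) (hρ : 0 ≤ ρ)
    (hbasic : SS + N * (l₂ / 2 * ρ) ≤ N * (l₂ * (a * RId)) + N * (8 * K * Z))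
    (hconc : PS ≤ n⁻¹ * SS + 10 * a * (ρ * ED) + 5 * a ^ 2 * s) :
    n⁻¹ * SS ≤ N / n * (l₂ * (a * RId) + 8 * K * Z) ∧
    μ * PS ≤ 160 * K * (μ * a ^ 2 * s + μ * a * RId * (N / n * l₂ + a * ED)
      + (a * ED / l₂ + N / n) * (μ * Z)) := by
  have h1 : n⁻¹ * SS ≤ N / n * (l₂ * (a * RId) + 8 * K * Z) := by
    have h0 : SS ≤ N * (l₂ * (a * RId) + 8 * K * Z) := by
      have : 0 ≤ N * (l₂ / 2 * ρ) := by positivity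
      linarith
    calc n⁻¹ * SS ≤ n⁻¹ * (N * (l₂ * (a * RId) + 8 * K * Z)) := by gcongr
      _ = _ := by ring
  have h2 : ρ ≤ 2 * a * RId + 16 * K * Z / l₂ := by
    have h0 : N * (l₂ / 2 * ρ) ≤ N * (l₂ * (a * RId) + 8 * K * Z) := by linarith
    have h0' := le_of_mul_le_mul_left h0 hN
    have h3 : l₂ * ρ ≤ l₂ * (2 * a * RId + 16 * K * Z / l₂) := by
      rw [mul_add, mul_div_cancel₀ _ hl₂.ne']; linarith
    exact le_of_mul_le_mul_left h3 hl₂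
  refine ⟨h1, ?_⟩
  have hK0 : 0 ≤ K := by linarith
  have hμ0 : 0 ≤ μ := by linarith
  have t1 : 0 ≤ μ * a ^ 2 * s := by positivity
  have t2 : 0 ≤ μ * a * RId * (N / n * l₂) := by positivity
  have t3 : 0 ≤ μ * a * RId * (a * ED) := by positivity
  have t4 : 0 ≤ a * ED / l₂ * (μ * Z) := by positivity
  have t5 : 0 ≤ N / n * (μ * Z) := by positivity
  calc μ * PS ≤ μ * (N / n * (l₂ * (a * RId) + 8 * K * Z)
        + 10 * a * ((2 * a * RId + 16 * K * Z / l₂) * ED) + 5 * a ^ 2 * s) := by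
        refine mul_le_mul_of_nonneg_left (hconc.trans ?_) hμ0
        gcongr
    _ = μ * a * RId * (N / n * l₂) + 8 * (K * (N / n * (μ * Z)))
        + 20 * (μ * a * RId * (a * ED)) + 160 * (K * (a * ED / l₂ * (μ * Z)))
        + 5 * (μ * a ^ 2 * s) := by ring
    _ ≤ 160 * (K * (μ * a * RId * (N / n * l₂))) + 160 * (K * (N / n * (μ * Z)))
        + 160 * (K * (μ * a * RId * (a * ED))) + 160 * (K * (a * ED / l₂ * (μ * Z)))
        + 160 * (K * (μ * a ^ 2 * s)) := by
        linarith [le_mul_of_one_le_left t1 hK, le_mul_of_one_le_left t2 hK,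
          le_mul_of_one_le_left t3 hK, mul_nonneg hK0 t5]
    _ = _ := by ring

/-- The error of the low-rank component, with squared Frobenius norm `F ^ 2` and nuclear norm `nu`,
from the basic inequality for it (`hbasic`), the decomposability of the nuclear norm (`hnu`, `hdn`)
and the concentration bound (`hconc`). The terms that are linear in `F` are absorbed into
`F ^ 2`. -/
theorem lowRank_error_le {n N M cI μ a s r l₁ l₂ RId EOp K Z SS SD SDD PD F q nu dn : ℝ}
    (hn : 0 < n) (hN : 0 < N) (hM : 0 < M) (hcI : 0 ≤ cI) (hμ : 1 ≤ μ) (ha : 0 ≤ a) (hs : 0 ≤ s)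
    (hr : 0 ≤ r) (hl₁ : 0 < l₁) (hl₂ : 0 < l₂) (hRId : 0 ≤ RId) (hEOp : 0 ≤ EOp) (hK : 1 ≤ K)
    (hZ : 0 ≤ Z) (hSD : 0 ≤ SD) (hF : 0 ≤ F) (hq : 0 ≤ q)
    (hSS : n⁻¹ * SS ≤ N / n * (l₂ * (a * RId) + 8 * K * Z))
    (hbasic : SD ≤ N * (l₁ * (nu / 2 + dn)) + N * (l₂ * (a * RId)) + N * (K * Z))
    (hnu : nu ≤ q + 2 * √r * F) (hdn : dn ≤ √r * F - q)
    (hconc : PD ≤ n⁻¹ * SDD + 20 * a * (nu * EOp) + 20 * a ^ 2 * s)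
    (hSDD : SDD ≤ 2 * SD + 2 * SS) (hFP : F ^ 2 ≤ M * (μ * PD) + 4 * a ^ 2 * cI) :
    F ^ 2 / M ≤ 28800 * K * (μ ^ 2 * M * r * ((N / n) ^ 2 * l₁ ^ 2 + a ^ 2 * EOp ^ 2)
      + a ^ 2 * μ * s + μ * a * RId * (l₂ * a / l₁ * EOp + N / n * l₂)
      + μ * Z * (a * EOp / l₁ + N / n) + a ^ 2 * cI / M) := by
  have hK0 : 0 ≤ K := by linarith
  have hμ0 : 0 ≤ μ := by linarith
  set w := √r * F with hw
  have hw0 : 0 ≤ w := by positivity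
  have hb : SD ≤ N * (l₁ * (2 * w - q / 2) + l₂ * (a * RId) + K * Z) := by
    have : N * (l₁ * (nu / 2 + dn)) ≤ N * (l₁ * (2 * w - q / 2)) := by
      gcongr
      linarith
    linarith
  have h1 : n⁻¹ * SD ≤ N / n * (2 * l₁ * w + l₂ * (a * RId) + K * Z) := by
    calc n⁻¹ * SD ≤ n⁻¹ * (N * (2 * l₁ * w + l₂ * (a * RId) + K * Z)) := by
          refine mul_le_mul_of_nonneg_left (hb.trans ?_) (by positivity)
          refine mul_le_mul_of_nonneg_left ?_ hN.le
          have : 0 ≤ l₁ * q := by positivity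
          linarith
      _ = _ := by ring
  have h2 : nu ≤ 6 * w + 2 * (l₂ * (a * RId) + K * Z) / l₁ := by
    have h0 : 0 ≤ l₁ * (2 * w - q / 2) + l₂ * (a * RId) + K * Z := by
      by_contra hneg
      have := mul_neg_of_pos_of_neg hN (not_le.1 hneg)
      linarith
    have h3 : l₁ * q ≤ l₁ * (4 * w + 2 * (l₂ * (a * RId) + K * Z) / l₁) := by
      rw [mul_add, mul_div_cancel₀ _ hl₁.ne']; linarith
    have h4 := le_of_mul_le_mul_left h3 hl₁
    linarith
  have h3 : n⁻¹ * SDD ≤ 2 * (n⁻¹ * SD) + 2 * (n⁻¹ * SS) := by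
    have := mul_le_mul_of_nonneg_left hSDD (inv_pos.2 hn).le
    linarith
  have h4 : a * (nu * EOp) ≤ a * ((6 * w + 2 * (l₂ * (a * RId) + K * Z) / l₁) * EOp) := by
    gcongr
  set A := μ * a * RId * (l₂ * a / l₁ * EOp) with hA
  set B := μ * a * RId * (N / n * l₂) with hB
  set C := μ * Z * (a * EOp / l₁) with hC
  set D := μ * Z * (N / n) with hD
  have hA0 : 0 ≤ A := by positivity
  have hB0 : 0 ≤ B := by positivity
  have hC0 : 0 ≤ C := by positivity
  have hD0 : 0 ≤ D := by positivity
  set y₁ := μ * √r * (N / n) * l₁ with hy₁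
  set y₂ := μ * √r * a * EOp with hy₂
  have h5 : μ * PD ≤ F * (4 * y₁) + F * (120 * y₂) + 4 * B + 18 * (K * D) + 40 * A
      + 40 * (K * C) + 20 * (a ^ 2 * μ * s) := by
    calc μ * PD ≤ μ * (2 * (N / n * (2 * l₁ * w + l₂ * (a * RId) + K * Z))
          + 2 * (N / n * (l₂ * (a * RId) + 8 * K * Z))
          + 20 * (a * ((6 * w + 2 * (l₂ * (a * RId) + K * Z) / l₁) * EOp))
          + 20 * a ^ 2 * s) := by
          refine mul_le_mul_of_nonneg_left ?_ hμ0
          linarith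
      _ = _ := by rw [hA, hB, hC, hD, hy₁, hy₂, hw]; ring
  have young : ∀ y : ℝ, F * y ≤ F ^ 2 / M / 4 + M * y ^ 2 := by
    intro y
    have : F ^ 2 / M / 4 + M * y ^ 2 - F * y = (F - 2 * M * y) ^ 2 / (4 * M) := by
      field_simp
      ring
    have : 0 ≤ (F - 2 * M * y) ^ 2 / (4 * M) := by positivity
    linarith
  have e1 : M * (4 * y₁) ^ 2 = 16 * (μ ^ 2 * M * r * ((N / n) ^ 2 * l₁ ^ 2)) := by
    rw [hy₁]; simp only [mul_pow]; rw [Real.sq_sqrt hr]; ring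
  have e2 : M * (120 * y₂) ^ 2 = 14400 * (μ ^ 2 * M * r * (a ^ 2 * EOp ^ 2)) := by
    rw [hy₂]; simp only [mul_pow]; rw [Real.sq_sqrt hr]; ring
  have h6 : F ^ 2 / M ≤ μ * PD + 4 * (a ^ 2 * cI / M) := by
    rw [div_le_iff₀ hM]
    have : (μ * PD + 4 * (a ^ 2 * cI / M)) * M = M * (μ * PD) + 4 * a ^ 2 * cI := by
      field_simp
    rw [this]; exact hFP
  set U₁ := μ ^ 2 * M * r * ((N / n) ^ 2 * l₁ ^ 2) with hU₁
  set U₂ := μ ^ 2 * M * r * (a ^ 2 * EOp ^ 2) with hU₂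
  set U₃ := a ^ 2 * μ * s with hU₃
  set U₄ := a ^ 2 * cI / M with hU₄
  have hU₁0 : 0 ≤ U₁ := by positivity
  have hU₂0 : 0 ≤ U₂ := by positivity
  have hU₃0 : 0 ≤ U₃ := by positivity
  have hU₄0 : 0 ≤ U₄ := by positivity
  have h7 : F ^ 2 / M ≤ 2 * (16 * U₁ + 14400 * U₂ + 4 * B + 18 * (K * D) + 40 * A
      + 40 * (K * C) + 20 * U₃ + 4 * U₄) := by
    have y1 := young (4 * y₁)
    have y2 := young (120 * y₂)
    rw [e1] at y1
    rw [e2] at y2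
    linarith
  have e3 : 28800 * K * (μ ^ 2 * M * r * ((N / n) ^ 2 * l₁ ^ 2 + a ^ 2 * EOp ^ 2)
      + a ^ 2 * μ * s + μ * a * RId * (l₂ * a / l₁ * EOp + N / n * l₂)
      + μ * Z * (a * EOp / l₁ + N / n) + a ^ 2 * cI / M)
      = 28800 * (K * U₁ + K * U₂ + K * U₃ + K * A + K * B + K * C + K * D + K * U₄) := by
    rw [hU₁, hU₂, hU₃, hU₄, hA, hB, hC, hD]; ring
  rw [e3]
  linarith [le_mul_of_one_le_left hA0 hK, le_mul_of_one_le_left hB0 hK,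
    le_mul_of_one_le_left hU₁0 hK, le_mul_of_one_le_left hU₂0 hK, le_mul_of_one_le_left hU₃0 hK,
    le_mul_of_one_le_left hU₄0 hK, mul_nonneg hK0 hC0, mul_nonneg hK0 hD0]

end ErrorBounds

/-! ### The error bounds on the good event -/

section Assembly

set_option maxHeartbeats 1000000 in
/-- The error bounds on the event where the two concentration inequalities (`hconcL` for the nuclear
norm, `hconcS` for the regularizer) and the bound on the corrupted noise (`hnoise`) hold. -/
theorem error_bounds_of_concentration {m₁ m₂ N : ℕ} (hm₁ : 0 < m₁) (hm₂ : 0 < m₂) (hN : 0 < N)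
    {R : Seminorm ℝ (Matrix (Fin m₁) (Fin m₂) ℝ)} {I : Finset (Fin m₁ × Fin m₂)}
    {L₀ S₀ L S : Matrix (Fin m₁) (Fin m₂) ℝ} {a l₁ l₂ : ℝ} {Om : Finset (Fin N)}
    {x : Fin N → Fin m₁ × Fin m₂} {ξ y : Fin N → ℝ} (hR : IsNorm R) (hRabs : IsAbsolute R)
    (hRdec : IsDecomposable R I) (hy : ∀ i, y i = (L₀ + S₀) (x i).1 (x i).2 + ξ i)
    (ha : 0 ≤ a) (hL₀ : SupNormLE L₀ a) (hS₀ : SupNormLE S₀ a)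
    (hS₀I : ∀ j k, (j, k) ∈ I → S₀ j k = 0) (hI : I.Nonempty) (hOm : Om.Nonempty)
    (hx : ∀ i ∈ Om, x i ∈ I) (hunobs : ∀ j k, (j, k) ∉ corruptedEntries Om x → S₀ j k = 0)
    (hl₂ : 0 < l₂) (hl₁ : 4 * opNorm (sigmaTerm Om x ξ) < l₁)
    (hl : 4 * (dualNorm R (sigmaTerm Om x ξ) + 2 * a * dualNorm R (wTerm Om x)) ≤ l₂)
    (hest : IsEstimator R a l₁ l₂ x y L S) {Q : Measure (Fin m₁ × Fin m₂)} {μ : ℝ} (hμ : 1 ≤ μ)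
    (hQ : ∀ p ∈ I, (μ * (I.card : ℝ))⁻¹ ≤ Q.real {p}) {σ K EOp ED : ℝ} (hK : 1 ≤ K)
    (hEOp : 0 ≤ EOp) (hED : 0 ≤ ED)
    (hconcL : ∀ B : Matrix (Fin m₁) (Fin m₂) ℝ, SupNormLE B (a + a) →
      ∑ p, Q.real {p} * B p.1 p.2 ^ 2 ≤
        (Om.card : ℝ)⁻¹ * ∑ i ∈ Om, B (x i).1 (x i).2 ^ 2
          + 10 * (a + a) * (nuclearNorm B * EOp)
          + 5 * (a + a) ^ 2 * √(Real.log ((m₁ : ℝ) + m₂) / Om.card))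
    (hconcS : ∀ B : Matrix (Fin m₁) (Fin m₂) ℝ, SupNormLE B a →
      ∑ p, Q.real {p} * B p.1 p.2 ^ 2 ≤
        (Om.card : ℝ)⁻¹ * ∑ i ∈ Om, B (x i).1 (x i).2 ^ 2
          + 10 * a * (R B * ED) + 5 * a ^ 2 * √(Real.log ((m₁ : ℝ) + m₂) / Om.card))
    (hnoise : ∑ i ∈ Omᶜ, ξ i ^ 2 ≤
      Omᶜ.card * (σ ^ 2 * (K * Real.log ((m₁ : ℝ) + m₂)))) :
    frobSq (L₀ - L) / (m₁ * m₂) + frobSq (S₀ - S) / (m₁ * m₂) ≤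
        30000 * K * (psi1 m₁ m₂ Om.card N L₀.rank μ a l₁ EOp
          + psi2 Om.card N μ a l₁ l₂ (R (onesOn (corruptedEntries Om x))) EOp ED
          + psi3 m₁ m₂ Om.card N Omᶜ.card Iᶜ.card μ a σ l₁ l₂ EOp ED) ∧
      frobSq (restrict I S) / I.card ≤
        30000 * K * psi4 m₁ m₂ Om.card N Omᶜ.card μ a σ l₂
          (R (onesOn (corruptedEntries Om x))) ED := by
  have hNR : (0 : ℝ) < N := by exact_mod_cast hN
  have hnR : (0 : ℝ) < Om.card := by exact_mod_cast hOm.card_pos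
  have hM : (0 : ℝ) < m₁ * m₂ := by positivity
  have hIR : (0 : ℝ) < I.card := by exact_mod_cast hI.card_pos
  have hIM : (I.card : ℝ) ≤ m₁ * m₂ := by
    have h := Finset.card_le_univ I
    rw [Fintype.card_prod, Fintype.card_fin, Fintype.card_fin] at h
    exact_mod_cast h
  have hl₁0 : 0 < l₁ := lt_of_le_of_lt (mul_nonneg zero_le_four (opNorm_nonneg _)) hl₁
  have hlog : 0 ≤ Real.log ((m₁ : ℝ) + m₂) := Real.log_nonneg (by
    have : (1 : ℝ) ≤ m₁ := by exact_mod_cast hm₁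
    have : (0 : ℝ) ≤ m₂ := Nat.cast_nonneg _
    linarith)
  have hK0 : 0 ≤ K := by linarith
  have hμ0 : 0 ≤ μ := by linarith
  set ld := Real.log ((m₁ : ℝ) + m₂) with hld
  set s := √(ld / Om.card) with hs
  have hs0 : 0 ≤ s := Real.sqrt_nonneg _
  set RId := R (onesOn (corruptedEntries Om x)) with hRIddef
  have hRId : 0 ≤ RId := apply_nonneg R _
  have hRS₀ : R S₀ ≤ a * RId := hRabs.le_mul_onesOn ha hS₀ hunobs
  set ct : ℝ := (Omᶜ.card : ℝ) with hct
  have hct0 : 0 ≤ ct := Nat.cast_nonneg _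
  set Z : ℝ := ct * (a ^ 2 + σ ^ 2 * ld) / N with hZdef
  have hZ : 0 ≤ Z := by positivity
  have hNZ : N * Z = ct * (a ^ 2 + σ ^ 2 * ld) := by rw [hZdef]; field_simp
  have hNl₂ : N * (l₂ * R S₀) ≤ N * (l₂ * (a * RId)) := by gcongr
  have hcta : 0 ≤ ct * a ^ 2 := by positivity
  have hnoise1 : ∑ i ∈ Omᶜ, ξ i ^ 2 ≤ N * (K * Z) := by
    have e : N * (K * Z) = K * (ct * a ^ 2) + ct * (σ ^ 2 * (K * ld)) := by
      rw [mul_left_comm, hNZ]; ring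
    rw [e]
    linarith [mul_nonneg hK0 hcta]
  have hnoise2 : ∑ i ∈ Omᶜ, (8 * a ^ 2 + 2 * ξ i ^ 2) ≤ N * (8 * K * Z) := by
    have e : N * (8 * K * Z) = 8 * (K * (ct * a ^ 2)) + 8 * (ct * (σ ^ 2 * (K * ld))) := by
      have : N * (8 * K * Z) = 8 * K * (N * Z) := by ring
      rw [this, hNZ]; ring
    have h0 : 0 ≤ ct * (σ ^ 2 * (K * ld)) := by positivity
    rw [Finset.sum_add_distrib, Finset.sum_const, nsmul_eq_mul, ← Finset.mul_sum, e]
    linarith [le_mul_of_one_le_left hcta hK]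
  -- the sparse component
  set SS := ∑ i ∈ Om, S (x i).1 (x i).2 ^ 2 with hSSdef
  set PS := ∑ p, Q.real {p} * (restrict I S) p.1 p.2 ^ 2 with hPSdef
  have hSS0 : 0 ≤ SS := Finset.sum_nonneg fun i _ => sq_nonneg _
  have hbasicS := sum_sq_sparse_le hN hR hRabs hRdec hy ha hL₀ hS₀ hS₀I hx hl₂ hl hest
  have hcS := hconcS (restrict I S) (hest.2.1.restrict ha I)
  rw [Finset.sum_congr rfl fun i (hi : i ∈ Om) =>
    by rw [restrict_apply_of_mem (hx i hi)]] at hcS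
  obtain ⟨hSS, hPS⟩ := sparse_error_le hnR hNR hμ ha hs0 hl₂ hRId hED hK hZ hSS0
    (apply_nonneg R (restrict I S)) (by linarith) hcS
  have hZμ : μ * ct * (a ^ 2 + σ ^ 2 * ld) / N = μ * Z := by rw [hZdef]; ring
  have hψ4 : psi4 m₁ m₂ Om.card N Omᶜ.card μ a σ l₂ RId ED
      = μ * a ^ 2 * s + μ * a * RId * (N / Om.card * l₂ + a * ED)
        + (a * ED / l₂ + N / Om.card) * (μ * Z) := by
    rw [psi4, ← hld, ← hs, ← hct, hZμ]
  rw [← hψ4] at hPS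
  have hψ40 : 0 ≤ psi4 m₁ m₂ Om.card N Omᶜ.card μ a σ l₂ RId ED := by
    rw [hψ4]; positivity
  have hfS : ∑ p ∈ I, S p.1 p.2 ^ 2 ≤ I.card * (μ * PS) := by
    have h := sum_sq_le_mul_sum_measure hI hμ hQ (restrict I S)
    rwa [Finset.sum_congr rfl fun p (hp : p ∈ I) =>
      by rw [restrict_apply_of_mem hp]] at h
  have hQnonneg : ∀ B : Matrix (Fin m₁) (Fin m₂) ℝ, 0 ≤ ∑ p, Q.real {p} * B p.1 p.2 ^ 2 :=
    fun B => Finset.sum_nonneg fun p _ => mul_nonneg measureReal_nonneg (sq_nonneg _)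
  refine ⟨?_, ?_⟩
  swap
  · rw [frobSq_restrict, div_le_iff₀ hIR]
    have h1 : I.card * (μ * PS) ≤ I.card *
        (160 * K * psi4 m₁ m₂ Om.card N Omᶜ.card μ a σ l₂ RId ED) := by gcongr
    have h2 := mul_nonneg hIR.le (mul_nonneg hK0 hψ40)
    linarith
  -- the low-rank component
  obtain ⟨q, hq, hnu, hdn⟩ := exists_nuclearNorm_compression L₀ L
  set SD := ∑ i ∈ Om, (L₀ (x i).1 (x i).2 - L (x i).1 (x i).2 - S (x i).1 (x i).2) ^ 2 with hSDdef
  have hSD0 : 0 ≤ SD := Finset.sum_nonneg fun i _ => sq_nonneg _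
  have hbasicL := sum_sq_add_le hN hR hRabs hRdec hy ha hL₀ hS₀ hS₀I hx hl₂ hl₁ hl hest
  have hcL := hconcL (L₀ - L) (hL₀.sub hest.1)
  have hSDD : ∑ i ∈ Om, (L₀ - L) (x i).1 (x i).2 ^ 2 ≤ 2 * SD + 2 * SS := by
    rw [hSDdef, hSSdef, Finset.mul_sum, Finset.mul_sum, ← Finset.sum_add_distrib]
    refine Finset.sum_le_sum fun i _ => ?_
    rw [Matrix.sub_apply]
    have := add_sq_le (a := L₀ (x i).1 (x i).2 - L (x i).1 (x i).2 - S (x i).1 (x i).2)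
      (b := S (x i).1 (x i).2)
    rw [sub_add_cancel] at this
    linarith
  have hFP : √(frobSq (L₀ - L)) ^ 2 ≤ (m₁ * m₂ : ℝ) *
      (μ * ∑ p, Q.real {p} * (L₀ - L) p.1 p.2 ^ 2) + 4 * a ^ 2 * Iᶜ.card := by
    rw [Real.sq_sqrt (frobSq_nonneg _)]
    refine (frobSq_le_sum_add (I := I) (hL₀.sub hest.1)).trans (add_le_add_left ?_ _)
    refine (sum_sq_le_mul_sum_measure hI hμ hQ (L₀ - L)).trans ?_
    exact mul_le_mul_of_nonneg_right hIM (mul_nonneg hμ0 (hQnonneg _))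
  have hL := lowRank_error_le hnR hNR hM (Nat.cast_nonneg _) hμ ha hs0 (Nat.cast_nonneg L₀.rank)
    hl₁0 hl₂ hRId hEOp hK hZ hSD0 (Real.sqrt_nonneg _) hq hSS (by linarith) hnu hdn
    (by linarith) hSDD hFP
  rw [Real.sq_sqrt (frobSq_nonneg _)] at hL
  have hSΔ : frobSq (S₀ - S) / (m₁ * m₂) ≤ μ * PS + 4 * (a ^ 2 * Iᶜ.card / (m₁ * m₂)) := by
    have h1 := frobSq_le_sum_add (I := I) (hS₀.sub hest.2.1)
    rw [Finset.sum_congr rfl fun p (hp : p ∈ I) => by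
      rw [Matrix.sub_apply, hS₀I p.1 p.2 hp, zero_sub, neg_sq]] at h1
    have h2 : (I.card : ℝ) * (μ * PS) ≤ (m₁ * m₂ : ℝ) * (μ * PS) :=
      mul_le_mul_of_nonneg_right hIM (mul_nonneg hμ0 (hQnonneg _))
    rw [div_le_iff₀ hM]
    have e : (μ * PS + 4 * (a ^ 2 * Iᶜ.card / (m₁ * m₂))) * (m₁ * m₂)
        = m₁ * m₂ * (μ * PS) + 4 * a ^ 2 * Iᶜ.card := by field_simp
    rw [e]
    linarith
  set cI : ℝ := (Iᶜ.card : ℝ) with hcI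
  have hψ1 : psi1 m₁ m₂ Om.card N L₀.rank μ a l₁ EOp
      = μ ^ 2 * (m₁ * m₂) * L₀.rank * ((N / Om.card) ^ 2 * l₁ ^ 2 + a ^ 2 * EOp ^ 2)
        + a ^ 2 * μ * s := by
    rw [psi1]; ring
  have hψ3 : psi3 m₁ m₂ Om.card N Omᶜ.card Iᶜ.card μ a σ l₁ l₂ EOp ED
      = μ * Z * (a * EOp / l₁ + a * ED / l₂ + N / Om.card) + a ^ 2 * cI / (m₁ * m₂) := by
    rw [psi3, ← hld, ← hct, hZμ]
  rw [hψ1, psi2, hψ3]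
  rw [hψ4] at hPS
  have g1 : 0 ≤ μ ^ 2 * (m₁ * m₂) * L₀.rank *
      ((N / Om.card) ^ 2 * l₁ ^ 2 + a ^ 2 * EOp ^ 2) := by positivity
  have g2 : 0 ≤ a ^ 2 * μ * s := by positivity
  have g3 : 0 ≤ μ * a * RId * (l₂ * a / l₁ * EOp) := by positivity
  have g4 : 0 ≤ μ * a * RId * (N / Om.card * l₂) := by positivity
  have g5 : 0 ≤ μ * a * RId * (a * ED) := by positivity
  have g6 : 0 ≤ μ * Z * (a * EOp / l₁) := by positivity
  have g7 : 0 ≤ μ * Z * (a * ED / l₂) := by positivity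
  have g8 : 0 ≤ μ * Z * (N / Om.card) := by positivity
  have g9 : 0 ≤ a ^ 2 * cI / (m₁ * m₂) := by positivity
  linarith [mul_nonneg hK0 g1, mul_nonneg hK0 g2, mul_nonneg hK0 g3, mul_nonneg hK0 g4,
    mul_nonneg hK0 g5, mul_nonneg hK0 g6, mul_nonneg hK0 g7, mul_nonneg hK0 g8,
    le_mul_of_one_le_left g9 hK]

theorem expSigmaR_nonneg {S : Type*} [MeasurableSpace S] (P : Measure S) {m₁ m₂ N : ℕ}
    (Om : Finset (Fin N)) (X : Fin N → S → Fin m₁ × Fin m₂)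
    {f : Matrix (Fin m₁) (Fin m₂) ℝ → ℝ} (hf : ∀ A, 0 ≤ f A) : 0 ≤ expSigmaR P Om X f :=
  integral_nonneg fun _ => div_nonneg (Finset.sum_nonneg fun _ _ => hf _) (by positivity)

theorem ae_mem_of_forall_measure_singleton_eq_zero {V : Type*} [Finite V] [MeasurableSpace V]
    {Q : Measure V} {I : Set V} (h : ∀ p, p ∉ I → Q {p} = 0) : ∀ᵐ p ∂Q, p ∈ I := by
  rw [ae_iff, ← Set.biUnion_of_singleton {p | p ∉ I}]
  exact (measure_biUnion_null_iff (Set.to_countable _)).2 h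

theorem exists_measurableSet_forall_of_ae {S : Type*} [MeasurableSpace S] {P : Measure S}
    {p : S → Prop} (h : ∀ᵐ ω ∂P, p ω) :
    ∃ E, MeasurableSet E ∧ P.real Eᶜ = 0 ∧ ∀ ω ∈ E, p ω := by
  obtain ⟨t, ht, htm, ht0⟩ := exists_measurable_superset_of_null (ae_iff.1 h)
  refine ⟨tᶜ, htm.compl, by rw [compl_compl, measureReal_def, ht0, ENNReal.toReal_zero],
    fun ω hω => ?_⟩
  by_contra hp
  exact hω (ht hp)

end Assembly

end RobustCompletion

open RobustCompletion in
theorem theorem1 (c₁ : ℝ) (_hc₁ : 0 < c₁) :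
    ∃ C : ℝ, 0 < C ∧
    ∀ (m₁ m₂ N : ℕ)
      -- the probability space, the positions `X i` of the sampled entries, and the noise
      (S : Type*) [MeasurableSpace S] (P : Measure S) [IsProbabilityMeasure P]
      (X : Fin N → S → Fin m₁ × Fin m₂) (_hX : ∀ i, Measurable (X i))
      (ξ : Fin N → S → ℝ) (_hξ : ∀ i, Measurable (ξ i))
      (_hξ_indep : iIndepFun ξ P) (_hξ_centered : ∀ i, ∫ ω, ξ i ω ∂P = 0)
      (_hXξ : IndepFun (fun ω i => X i ω) (fun ω i => ξ i ω) P)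
      -- the unknown matrices and the trace regression model
      (L₀ S₀ : Matrix (Fin m₁) (Fin m₂) ℝ) (Y : Fin N → S → ℝ)
      (_hY : ∀ i ω, Y i ω = ((basisMatrix (X i ω)).transpose * (L₀ + S₀)).trace + ξ i ω)
      (a : ℝ) (_hL₀ : SupNormLE L₀ a) (_hS₀ : SupNormLE S₀ a)
      -- the index set `I` of non-corrupted entries, the set `Om` of non-corrupted observations
      (I : Finset (Fin m₁ × Fin m₂)) (_hS₀I : ∀ j k, (j, k) ∈ I → S₀ j k = 0)
      (Om : Finset (Fin N)) (_hOm : Om.Nonempty)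
      -- non-corrupted observations: i.i.d. with a distribution `Q` on `I`
      (Q : Measure (Fin m₁ × Fin m₂)) [IsProbabilityMeasure Q]
      (_hQI : ∀ p, p ∉ I → Q {p} = 0)
      (_hlaw : ∀ i ∈ Om, P.map (X i) = Q)
      (_hX_indep : iIndepFun (fun i : Om => X i) P)
      -- corrupted observations: arbitrary in the complement of `I`;
      -- the unobserved entries of `S₀` are zero
      (_hcorr : ∀ᵐ ω ∂P, ∀ i, i ∉ Om → X i ω ∉ I)
      (_hunobs : ∀ᵐ ω ∂P, ∀ j k, (j, k) ∉ corruptedEntries Om (fun i => X i ω) → S₀ j k = 0)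
      -- the assumptions on the sampling distribution and on the noise
      (μ : ℝ) (_hμ : 1 ≤ μ) (_hQμ : ∀ p ∈ I, (μ * (I.card : ℝ))⁻¹ ≤ Q.real {p})
      (Lc : ℝ) (_hLc : 1 ≤ Lc)
      (_hcol : ∀ k, ∑ j, Q.real {(j, k)} ≤ Lc / (min m₁ m₂ : ℕ))
      (_hrow : ∀ j, ∑ k, Q.real {(j, k)} ≤ Lc / (min m₁ m₂ : ℕ))
      (σ : ℝ) (_hσ : 0 < σ)
      (_hsub : ∀ i, Integrable (fun ω => Real.exp (ξ i ω ^ 2 / σ ^ 2)) P ∧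
        ∫ ω, Real.exp (ξ i ω ^ 2 / σ ^ 2) ∂P < c₁)
      -- the regularizer
      (R : Seminorm ℝ (Matrix (Fin m₁) (Fin m₂) ℝ)) (_hR : IsNorm R) (_hRabs : IsAbsolute R)
      (_hRdec : IsDecomposable R I),
    ∃ E : Set S, MeasurableSet E ∧ 1 - 4.5 / ((m₁ : ℝ) + m₂) ≤ P.real E ∧
      ∀ ω ∈ E, ∀ l₁ l₂ : ℝ, 0 < l₂ →
        4 * opNorm (sigmaTerm Om (fun i => X i ω) (fun i => ξ i ω)) < l₁ →
        4 * (dualNorm R (sigmaTerm Om (fun i => X i ω) (fun i => ξ i ω))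
          + 2 * a * dualNorm R (wTerm Om (fun i => X i ω))) ≤ l₂ →
        ∀ L S : Matrix (Fin m₁) (Fin m₂) ℝ,
          IsEstimator R a l₁ l₂ (fun i => X i ω) (fun i => Y i ω) L S →
          frobSq (L₀ - L) / (m₁ * m₂) + frobSq (S₀ - S) / (m₁ * m₂) ≤
            C * (psi1 m₁ m₂ Om.card N L₀.rank μ a l₁ (expSigmaR P Om X opNorm)
              + psi2 Om.card N μ a l₁ l₂ (R (onesOn (corruptedEntries Om (fun i => X i ω))))
                  (expSigmaR P Om X opNorm) (expSigmaR P Om X (dualNorm R))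
              + psi3 m₁ m₂ Om.card N Omᶜ.card Iᶜ.card μ a σ l₁ l₂
                  (expSigmaR P Om X opNorm) (expSigmaR P Om X (dualNorm R))) ∧
          frobSq (restrict I S) / I.card ≤
            C * psi4 m₁ m₂ Om.card N Omᶜ.card μ a σ l₂
              (R (onesOn (corruptedEntries Om (fun i => X i ω))))
              (expSigmaR P Om X (dualNorm R)) := by
  -- `log c₁ + log d ≤ K log d` for `d ≥ 2`
  set K : ℝ := 1 + |Real.log c₁| / Real.log 2 with hKdef
  have hlog2 : 0 < Real.log 2 := Real.log_pos one_lt_two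
  have hK : 1 ≤ K := le_add_of_nonneg_right (by positivity)
  refine ⟨30000 * K, by positivity, ?_⟩
  intro m₁ m₂ N S _ P _ X hX ξ hξ _ _ _ L₀ S₀ Y hY a hL₀ hS₀ I hS₀I Om hOm Q _ hQI hlaw hind
    _ hunobs μ hμ hQμ _ _ _ _ σ hσ hsub R hR hRabs hRdec
  obtain ⟨i₀, hi₀⟩ := hOm
  obtain ⟨ω₀⟩ : Nonempty S := nonempty_of_isProbabilityMeasure P
  have hm₁ : 0 < m₁ := Fin.pos (X i₀ ω₀).1
  have hm₂ : 0 < m₂ := Fin.pos (X i₀ ω₀).2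
  have hN : 0 < N := Fin.pos i₀
  have ha : 0 ≤ a := (abs_nonneg _).trans (hL₀ (X i₀ ω₀).1 (X i₀ ω₀).2)
  have hd : (2 : ℝ) ≤ (m₁ : ℝ) + m₂ := by
    have h1 : (1 : ℝ) ≤ m₁ := by exact_mod_cast hm₁
    have h2 : (1 : ℝ) ≤ m₂ := by exact_mod_cast hm₂
    linarith
  set d : ℝ := (m₁ : ℝ) + m₂ with hddef
  have hd0 : 0 < d := by linarith
  have hQae : ∀ᵐ p ∂Q, p ∈ (I : Set (Fin m₁ × Fin m₂)) :=
    ae_mem_of_forall_measure_singleton_eq_zero fun p hp => hQI p (by simpa using hp)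
  have hI : I.Nonempty := by
    obtain ⟨p, hp⟩ := hQae.exists
    exact ⟨p, hp⟩
  have hXI : ∀ᵐ ω ∂P, ∀ i, i ∈ Om → X i ω ∈ I := by
    refine ae_all_iff.2 fun i => ?_
    by_cases hi : i ∈ Om
    · rw [← hlaw i hi] at hQae
      filter_upwards [ae_of_ae_map (hX i).aemeasurable hQae] with ω hω _ using hω
    · exact Filter.Eventually.of_forall fun ω h => absurd h hi
  obtain ⟨E₀, hE₀m, hE₀P, hE₀⟩ := exists_measurableSet_forall_of_ae (hXI.and hunobs)
  obtain ⟨E₁, hE₁m, hE₁P, hE₁⟩ := exists_event_sum_noise_sq_le hξ hσ _hc₁ hsub Omᶜ hd0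
  obtain ⟨E₂, hE₂m, hE₂P, hE₂⟩ := exists_event_sum_sq_le hX ⟨i₀, hi₀⟩ hlaw hind
    nuclearNorm_nonneg nuclearNorm_zero opNorm_nonneg matInner_le_opNorm_mul_nuclearNorm
    (add_nonneg ha ha) hd
  obtain ⟨E₃, hE₃m, hE₃P, hE₃⟩ := exists_event_sum_sq_le hX ⟨i₀, hi₀⟩ hlaw hind
    (apply_nonneg R) (map_zero R) (dualNorm_nonneg hR hRabs) (matInner_le_dualNorm_mul hR hRabs)
    ha hd
  have hEm : MeasurableSet (E₀ ∩ E₁ ∩ (E₂ ∩ E₃)) :=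
    (hE₀m.inter hE₁m).inter (hE₂m.inter hE₃m)
  refine ⟨E₀ ∩ E₁ ∩ (E₂ ∩ E₃), hEm, ?_, ?_⟩
  · have h1 : P.real (E₀ ∩ E₁ ∩ (E₂ ∩ E₃))ᶜ ≤ 3 * (1 / d) := by
      rw [Set.compl_inter, Set.compl_inter, Set.compl_inter]
      have u1 := measureReal_union_le (μ := P) (E₀ᶜ ∪ E₁ᶜ) (E₂ᶜ ∪ E₃ᶜ)
      have u2 := measureReal_union_le (μ := P) E₀ᶜ E₁ᶜ
      have u3 := measureReal_union_le (μ := P) E₂ᶜ E₃ᶜ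
      linarith
    rw [probReal_compl_eq_one_sub hEm] at h1
    have h2 : 4.5 / d = 4.5 * (1 / d) := by ring
    have h3 : 0 < 1 / d := by positivity
    linarith
  · rintro ω ⟨⟨hω₀, hω₁⟩, hω₂, hω₃⟩ l₁ l₂ hl₂ hl₁ hl L S' hest
    obtain ⟨hx, hun⟩ := hE₀ ω hω₀
    have hlogd : Real.log 2 ≤ Real.log d := Real.log_le_log two_pos hd
    refine error_bounds_of_concentration hm₁ hm₂ hN hR hRabs hRdec
      (fun i => by rw [hY i ω, trace_transpose_basisMatrix_mul]) ha hL₀ hS₀ hS₀I hI ⟨i₀, hi₀⟩ hx hun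
      hl₂ hl₁ hl hest hμ hQμ hK (expSigmaR_nonneg P Om X opNorm_nonneg)
      (expSigmaR_nonneg P Om X (dualNorm_nonneg hR hRabs)) (hE₂ ω hω₂) (hE₃ ω hω₃)
      ((hE₁ ω hω₁).trans ?_)
    gcongr
    have h1 : |Real.log c₁| ≤ |Real.log c₁| / Real.log 2 * Real.log d := by
      rw [div_mul_eq_mul_div, le_div_iff₀ hlog2]
      exact mul_le_mul_of_nonneg_left hlogd (abs_nonneg _)
    rw [hKdef, add_mul, one_mul]
    linarith [le_abs_self (Real.log c₁)]
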